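/- Let $s\ge 1$. For a finite graph $G$, let $\alpha_s(G)$ denote the maximum number of vertices in an induced subgraph of $G$ that contains no $K_s$. For a graph $H$ and a real number $f$, let $\mathrm{RT}_s(n,H,f)$ denote the maximum number of edges in an $H$-free graph $G$ on $n$ vertices with $\alpha_s(G)<f$; if no such graph exists, put $\mathrm{RT}_s(n,H,f)=0$. (1) Let $r\ge 1$ be an integer and let $\varepsilon>0$ and $\frac12<\delta\le \frac12+\frac1{2(2r+1)}$ be real numbers. Then there is $s_0=s_0(r,\varepsilon,\delta)$ such that for every integer $s\ge s_0$, $$\mathrm{RT}_s(n,K_{s+r},n^{\delta})=\Omega\!\left(n^{2-(1-\delta)/r-\varepsilon}\right)\qquad (n\to\infty).$$ (2) There are positive constants $C=C(s)$, depending only on $s$, such that for every integer $r\ge 2$ and every real $\varepsilon>0$ there is $s_0=s_0(r,\varepsilon)$ such that for every integer $s\ge s_0$, $$\mathrm{RT}_s(n,K_{s+r},C(s)\sqrt n)=\Omega\!\left(n^{2-1/(2r)-\varepsilon}\right)\qquad (n\to\infty).$$ In both parts $n$ runs over the positive integers, and the constant implied by $\Omega$ (and the threshold on $n$) may depend on $r,\varepsilon,s$,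 and in (1) also on $\delta$. -/

import Mathlib

open Filter Asymptotics

/-- The `s`-independence number `α_s(G)` of a finite graph: the maximum number of vertices of an
induced subgraph of `G` that contains no `K_s`. -/
noncomputable def sIndepNum {V : Type*} [Fintype V] (s : ℕ) (G : SimpleGraph V) : ℕ :=
  sSup {k : ℕ | ∃ S : Finset V, (G.induce (S : Set V)).CliqueFree s ∧ S.card = k}

/-- The Ramsey–Turán number `RT_s(n, H, f)`: the maximum number of edges of an `H`-free graph `G`
on `n` vertices with `α_s(G) < f`, and `0` if there is no such graph (`sSup ∅ = 0` in `ℕ`). -/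
noncomputable def ramseyTuran {W : Type*} (s n : ℕ) (H : SimpleGraph W) (f : ℝ) : ℕ :=
  sSup {m : ℕ | ∃ G : SimpleGraph (Fin n),
    H.Free G ∧ (sIndepNum s G : ℝ) < f ∧ G.edgeSet.ncard = m}

/-!
The graph is a union of a graph that keeps `s`-independent sets small and a sparse random graph that
carries the edges. Put the `n` points into the affine plane over a prime field of order `q ≈ √n`.
Select each line with probability about `n ^ (δ - 1 + ε)`, keep each point of a selected line with
probability about `n ^ (1 / 2 - δ)`, colour the kept points of each line with `s` random colours, and
join kept points of different colours on the line. Add every pair on no selected line with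
probability `n ^ (-c)`, where `c` is slightly larger than `(1 - δ) / r`.

* A set of `C n ^ δ` points meets a positive proportion of all lines in about its average number of
  points (`sq_le_eight_mul_card_rich`), and each such line, once selected, shows all `s` colours in
  the set with probability at least `1 / 2`. The number of selected lines exceeds `n ^ δ log n`, so a
  union bound over all sets gives a `K_s` inside each of them (`card_exists_no_rainbow_le`).
* Two points are kept on a common selected line with probability at most `n ^ (-(δ - ε)) ≤ n ^ (-c)`,
  so every adjacency costs at least `n ^ (-c)`, as long as different pairs use different lines. A
  clique large in terms of `r` and the exponents contains either a large balanced complete bipartite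
  graph whose pairs use different lines, or many points of one line `L`; at most `s` points of the
  clique are kept on `L`, so in a clique of size `s + r` there are also `r` points outside, and these
  are joined to the points on `L` through different lines (`exists_joined_of_isClique`). The first
  pattern on `2 j` points has expected number about `n ^ (2 j - c j ^ 2)`. In the second one, each of
  the `k` points on `L` contributes the factor `n ^ (1 - δ) * n ^ (-c r)`, a negative power of `n`. So
  for large `j`, `k` neither occurs, and the threshold on `s` depends on `j`, `k` and `r` only.
* The expected number of edges is of order `n ^ (2 - c)`, which is far more than the bad events can
  account for (`exists_graph_of_incidence`).

The case `δ = 1 / 2`, where all points of a selected line are kept, needs `(1 - δ) / r < δ` and thus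
`r ≥ 2`; it is the second part. The first part follows by lowering `δ` a little, which absorbs the
constant `C`.
-/

/-! ### The random construction -/

/-- The outcomes of the random experiment, with the uniform distribution: every line `l` gets a label
in `Fin P` and is selected if the label is `0`; every pair of a line and a point gets a label in
`Fin N`, the point being kept on the line if the label is `0`, together with a colour in `Fin s`; and
every pair of points gets a label in `Fin M`, a label `0` marking a candidate for a sparse edge. -/
abbrev Sample (V Λ : Type*) (P N M s : ℕ) : Type _ :=
  (Λ → Fin P × (V → Fin N × Fin s)) × (Sym2 V → Fin M)

section Sample

variable {V Λ : Type*} {P N M s : ℕ} [NeZero P] [NeZero N] [NeZero M]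

/-- The point `v` lies on the line `l`, the line `l` is selected, and `v` is kept on it. -/
def Kept (I : Λ → V → Prop) (ω : Sample V Λ P N M s) (l : Λ) (v : V) : Prop :=
  I l v ∧ (ω.1 l).1 = 0 ∧ ((ω.1 l).2 v).1 = 0

/-- The random graph: two points are adjacent if they are kept with different colours on a common
selected line, or if their pair has label `0` and no selected line passes through both of them (kept
or not). The last proviso makes the points kept on a selected line span a complete multipartite
graph with at most `s` parts. -/
def sampleGraph (I : Λ → V → Prop) (ω : Sample V Λ P N M s) : SimpleGraph V where
  Adj v w := v ≠ w ∧
    ((∃ l, Kept I ω l v ∧ Kept I ω l w ∧ ((ω.1 l).2 v).2 ≠ ((ω.1 l).2 w).2) ∨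
      (ω.2 s(v, w) = 0 ∧ ∀ l, I l v → I l w → (ω.1 l).1 ≠ 0))
  symm := ⟨by
    rintro v w ⟨hne, h⟩
    refine ⟨hne.symm, ?_⟩
    rcases h with ⟨l, h1, h2, h3⟩ | ⟨h1, h2⟩
    · exact Or.inl ⟨l, h2, h1, h3.symm⟩
    · exact Or.inr ⟨by rwa [Sym2.eq_swap], fun l hw hv => h2 l hv hw⟩⟩
  loopless := ⟨fun v h => h.1 rfl⟩

variable [Fintype V] [Fintype Λ]

open Classical in
/-- Prescribed labels `0` are independent events of probabilities `1 / P`, `1 / N` and `1 / M`. -/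
theorem card_sample_filter_eq_zero (A : Finset Λ) (B : Finset (Λ × V)) (E : Finset (Sym2 V)) :
    (Finset.univ.filter fun ω : Sample V Λ P N M s =>
      (∀ l ∈ A, (ω.1 l).1 = 0) ∧ (∀ p ∈ B, ((ω.1 p.1).2 p.2).1 = 0) ∧ ∀ e ∈ E, ω.2 e = 0).card
      * (P ^ A.card * N ^ B.card * M ^ E.card) = Fintype.card (Sample V Λ P N M s) := by
  have hset : (Finset.univ.filter fun ω : Sample V Λ P N M s =>
      (∀ l ∈ A, (ω.1 l).1 = 0) ∧ (∀ p ∈ B, ((ω.1 p.1).2 p.2).1 = 0) ∧ ∀ e ∈ E, ω.2 e = 0) =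
      (Fintype.piFinset fun l => (if l ∈ A then {0} else Finset.univ) ×ˢ
        Fintype.piFinset fun v => (if (l, v) ∈ B then {0} else Finset.univ) ×ˢ Finset.univ) ×ˢ
      Fintype.piFinset fun e => if e ∈ E then {0} else Finset.univ := by
    ext ω
    simp only [Finset.mem_filter, Finset.mem_univ, true_and, Finset.mem_product,
      Fintype.mem_piFinset, and_true]
    constructor
    · rintro ⟨h1, h2, h3⟩
      refine ⟨fun l => ⟨?_, fun v => ?_⟩, fun e => ?_⟩
      · split_ifs with h <;> simp [h1 _, h]
      · split_ifs with h
        · simpa using h2 _ h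
        · simp
      · split_ifs with h <;> simp [h3 _, h]
    · rintro ⟨h1, h3⟩
      refine ⟨fun l hl => ?_, fun p hp => ?_, fun e he => ?_⟩
      · simpa [hl] using (h1 l).1
      · simpa [hp] using (h1 p.1).2 p.2
      · simpa [he] using h3 e
  have hA : P ^ A.card = ∏ l : Λ, if l ∈ A then P else 1 := by
    simp [Finset.prod_ite_mem, Finset.prod_const]
  have hB : N ^ B.card = ∏ l : Λ, ∏ v : V, if (l, v) ∈ B then N else 1 := by
    rw [← Fintype.prod_prod_type' (f := fun l v => if (l, v) ∈ B then N else 1)]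
    simp [Finset.prod_ite_mem, Finset.prod_const]
  have hE : M ^ E.card = ∏ e : Sym2 V, if e ∈ E then M else 1 := by
    simp [Finset.prod_ite_mem, Finset.prod_const]
  have aux : ∀ (c : Prop) [Decidable c] (m : ℕ) [NeZero m],
      (if c then ({0} : Finset (Fin m)) else Finset.univ).card * (if c then m else 1) = m := by
    intro c _ m _
    split_ifs <;> simp
  have h1 : (∏ l : Λ, ((if l ∈ A then ({0} : Finset (Fin P)) else Finset.univ).card *
      ∏ v : V, ((if (l, v) ∈ B then ({0} : Finset (Fin N)) else Finset.univ).card * s))) *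
      (P ^ A.card * N ^ B.card) = ∏ _l : Λ, (P * ∏ _v : V, (N * s)) := by
    rw [hA, hB, ← Finset.prod_mul_distrib, ← Finset.prod_mul_distrib]
    refine Finset.prod_congr rfl fun l _ => ?_
    calc _ = ((if l ∈ A then ({0} : Finset (Fin P)) else Finset.univ).card *
            (if l ∈ A then P else 1)) *
          ((∏ v : V, ((if (l, v) ∈ B then ({0} : Finset (Fin N)) else Finset.univ).card * s)) *
            ∏ v : V, (if (l, v) ∈ B then N else 1)) := by ring
      _ = _ := by
        rw [aux, ← Finset.prod_mul_distrib]
        congr 1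
        refine Finset.prod_congr rfl fun v _ => ?_
        rw [mul_right_comm, aux]
  have h2 : (∏ e : Sym2 V, (if e ∈ E then ({0} : Finset (Fin M)) else Finset.univ).card) *
      M ^ E.card = ∏ _e : Sym2 V, M := by
    rw [hE, ← Finset.prod_mul_distrib]
    exact Finset.prod_congr rfl fun e _ => aux _ _
  rw [hset, Finset.card_product, Fintype.card_piFinset, Fintype.card_piFinset]
  simp only [Finset.card_product, Fintype.card_piFinset, Finset.card_univ, Fintype.card_fin]
  rw [mul_mul_mul_comm, h1, h2]
  simp [Fintype.card_prod, Fintype.card_pi]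

open Classical in
/-- The event that each pair `f i, g i` is made adjacent, through the line `m i` for `i ∈ T` and
through a label `0` of the pair for `i ∉ T`, while further incidences `B` are kept. If the lines are
distinct, each pair costs a factor `1 / (P N ^ 2)` or `1 / M`, hence at most `1 / X`. -/
theorem card_pattern_le {ι : Type*} [Fintype ι] (f g : ι → V) (m : ι → Λ) (T : Finset ι)
    (B : Finset (Λ × V)) (hfg : Function.Injective fun i => s(f i, g i)) (hne : ∀ i, f i ≠ g i)
    (hm : Set.InjOn m T) (hB : ∀ i ∈ T, ∀ p ∈ B, m i ≠ p.1) {X : ℝ} (hX : 0 ≤ X)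
    (hXP : X ≤ P * N ^ 2) (hXM : X ≤ M) :
    ((Finset.univ.filter fun ω : Sample V Λ P N M s =>
      (∀ i ∈ T, (ω.1 (m i)).1 = 0 ∧ ((ω.1 (m i)).2 (f i)).1 = 0 ∧ ((ω.1 (m i)).2 (g i)).1 = 0) ∧
      (∀ i ∉ T, ω.2 s(f i, g i) = 0) ∧ ∀ p ∈ B, ((ω.1 p.1).2 p.2).1 = 0).card : ℝ)
      * (X ^ Fintype.card ι * N ^ B.card) ≤ Fintype.card (Sample V Λ P N M s) := by
  set A := T.image m with hA
  set B₁ := T.image fun i => (m i, f i) with hB₁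
  set B₂ := T.image fun i => (m i, g i) with hB₂
  set E := (Finset.univ \ T).image fun i => s(f i, g i) with hE
  have cA : A.card = T.card := Finset.card_image_of_injOn hm
  have cB₁ : B₁.card = T.card := Finset.card_image_of_injOn fun i hi j hj h =>
    hm hi hj (Prod.ext_iff.1 h).1
  have cB₂ : B₂.card = T.card := Finset.card_image_of_injOn fun i hi j hj h =>
    hm hi hj (Prod.ext_iff.1 h).1
  have cE : E.card = Fintype.card ι - T.card := by
    rw [hE, Finset.card_image_of_injective _ hfg, Finset.card_univ_sdiff]
  have d1 : Disjoint B₁ B₂ := by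
    rw [Finset.disjoint_left]
    intro p hp hq
    simp only [hB₁, hB₂, Finset.mem_image] at hp hq
    obtain ⟨i, hi, rfl⟩ := hp
    obtain ⟨j, hj, h⟩ := hq
    obtain ⟨h1, h2⟩ := Prod.ext_iff.1 h
    obtain rfl := hm hj hi h1
    exact hne _ h2.symm
  have d2 : Disjoint (B₁ ∪ B₂) B := by
    rw [Finset.disjoint_left]
    intro p hp hq
    simp only [hB₁, hB₂, Finset.mem_union, Finset.mem_image] at hp
    rcases hp with ⟨i, hi, rfl⟩ | ⟨i, hi, rfl⟩ <;> exact hB i hi _ hq rfl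
  have hcard := card_sample_filter_eq_zero (P := P) (N := N) (M := M) (s := s) A (B₁ ∪ B₂ ∪ B) E
  rw [Finset.card_union_of_disjoint d2, Finset.card_union_of_disjoint d1, cA, cB₁, cB₂, cE] at hcard
  have hset : (Finset.univ.filter fun ω : Sample V Λ P N M s =>
      (∀ i ∈ T, (ω.1 (m i)).1 = 0 ∧ ((ω.1 (m i)).2 (f i)).1 = 0 ∧ ((ω.1 (m i)).2 (g i)).1 = 0) ∧
      (∀ i ∉ T, ω.2 s(f i, g i) = 0) ∧ ∀ p ∈ B, ((ω.1 p.1).2 p.2).1 = 0) =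
      Finset.univ.filter fun ω : Sample V Λ P N M s =>
      (∀ l ∈ A, (ω.1 l).1 = 0) ∧ (∀ p ∈ B₁ ∪ B₂ ∪ B, ((ω.1 p.1).2 p.2).1 = 0) ∧
        ∀ e ∈ E, ω.2 e = 0 := by
    refine Finset.filter_congr fun ω _ => ?_
    simp only [hA, hB₁, hB₂, hE, Finset.mem_union, Finset.mem_image, Finset.mem_sdiff,
      Finset.mem_univ, true_and, forall_exists_index, and_imp, or_imp, forall_and,
      forall_apply_eq_imp_iff₂]
    tauto
  rw [hset, ← hcard]
  push_cast
  have hT : T.card ≤ Fintype.card ι := Finset.card_le_univ T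
  have key : X ^ Fintype.card ι ≤ (P * N ^ 2 : ℝ) ^ T.card * M ^ (Fintype.card ι - T.card) := by
    conv_lhs => rw [← Nat.add_sub_cancel' hT, pow_add]
    gcongr
  calc _ ≤ _ * (((P * N ^ 2 : ℝ) ^ T.card * M ^ (Fintype.card ι - T.card)) * N ^ B.card) := by
        gcongr
    _ = _ := by ring

end Sample

/-! ### Large cliques force a bipartite pattern -/

section Clique

variable {V Λ : Type*} {P N M s : ℕ} [NeZero P] [NeZero N] [NeZero M]

/-- The `a + b` points `x`, `y` are distinct, and the lines `ℓ (x i) (y k)` for `(i, k) ∈ T` are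
pairwise distinct. Here `ℓ v w` stands for the line through `v` and `w`. -/
structure IsGeneric {a b : ℕ} (ℓ : V → V → Λ) (x : Fin a → V) (y : Fin b → V)
    (T : Finset (Fin a × Fin b)) : Prop where
  left_injective : Function.Injective x
  right_injective : Function.Injective y
  ne : ∀ i k, x i ≠ y k
  injOn : Set.InjOn (fun p : Fin a × Fin b => ℓ (x p.1) (y p.2)) T

/-- The labels of `ω` account for every adjacency between the points `x` and the points `y`: through
the line `ℓ (x i) (y k)` for `(i, k) ∈ T`, through the label of the pair otherwise. -/
def IsJoined {a b : ℕ} (ω : Sample V Λ P N M s) (ℓ : V → V → Λ) (x : Fin a → V) (y : Fin b → V)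
    (T : Finset (Fin a × Fin b)) : Prop :=
  (∀ p ∈ T, (ω.1 (ℓ (x p.1) (y p.2))).1 = 0 ∧ ((ω.1 (ℓ (x p.1) (y p.2))).2 (x p.1)).1 = 0 ∧
    ((ω.1 (ℓ (x p.1) (y p.2))).2 (y p.2)).1 = 0) ∧
  ∀ p ∉ T, ω.2 s(x p.1, y p.2) = 0

variable {I : Λ → V → Prop} {ω : Sample V Λ P N M s} {ℓ : V → V → Λ}

theorem sampleGraph_adj_cases (hℓ : ∀ v w l, v ≠ w → I l v → I l w → ℓ v w = l) {v w : V}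
    (h : (sampleGraph I ω).Adj v w) (hnot : ¬ (Kept I ω (ℓ v w) v ∧ Kept I ω (ℓ v w) w)) :
    ω.2 s(v, w) = 0 := by
  obtain ⟨hne, ⟨l, h1, h2, -⟩ | h⟩ := h
  · obtain rfl := hℓ v w l hne h1.1 h2.1
    exact absurd ⟨h1, h2⟩ hnot
  · exact h.1

open Classical in
theorem card_filter_kept_le (hℓ : ∀ v w l, v ≠ w → I l v → I l w → ℓ v w = l) {K : Finset V}
    (hK : (sampleGraph I ω).IsClique K) (L : Λ) : (K.filter (Kept I ω L)).card ≤ s := by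
  have hinj : Set.InjOn (fun v => ((ω.1 L).2 v).2) (K.filter (Kept I ω L)) := by
    intro v hv w hw hvw
    by_contra hne
    simp only [Finset.coe_filter, Set.mem_ofPred_eq] at hv hw
    obtain ⟨-, ⟨l, h1, h2, h3⟩ | h⟩ := hK hv.1 hw.1 hne
    · have : l = L := (hℓ v w l hne h1.1 h2.1).symm.trans (hℓ v w L hne hv.2.1 hw.2.1)
      subst this
      exact h3 hvw
    · exact h.2 L hv.2.1 hw.2.1 hv.2.2.1
  simpa using Finset.card_le_card_of_injOn _ (fun v _ => Finset.mem_univ _) hinj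

/-- A clique with no three points kept on a line contains a balanced complete bipartite pattern: two
pairs sharing a line would put three points on it. -/
theorem exists_joined_of_no_three (hℓ : ∀ v w l, v ≠ w → I l v → I l w → ℓ v w = l) {J : Finset V}
    (hJ : (sampleGraph I ω).IsClique J) {j : ℕ} (hcard : 2 * j ≤ J.card)
    (h3 : ∀ l, ∀ u ∈ J, ∀ v ∈ J, ∀ w ∈ J, Kept I ω l u → Kept I ω l v → Kept I ω l w →
      u = v ∨ u = w ∨ v = w) :
    ∃ (x y : Fin j → V) (T : Finset (Fin j × Fin j)), IsGeneric ℓ x y T ∧ IsJoined ω ℓ x y T := by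
  classical
  obtain ⟨J', hJJ, hc⟩ := Finset.exists_subset_card_eq hcard
  rw [two_mul] at hc
  set e := (J'.equivFinOfCardEq hc).symm
  have heJ : ∀ i, (e i : V) ∈ J := fun i => hJJ (e i).2
  have hinj : ∀ {i k}, (e i : V) = e k → i = k := fun h => e.injective (Subtype.ext h)
  set x : Fin j → V := fun i => e (Fin.castAdd j i)
  set y : Fin j → V := fun i => e (Fin.natAdd j i)
  have hx : Function.Injective x := fun i k h => Fin.castAdd_injective j j (hinj h)
  have hy : Function.Injective y := fun i k h => Fin.natAdd_injective j j (hinj h)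
  have hxy : ∀ i k, x i ≠ y k := fun i k h => by
    have := congrArg Fin.val (hinj h)
    simp at this
    omega
  have hxJ : ∀ i, x i ∈ J := fun i => heJ _
  have hyJ : ∀ i, y i ∈ J := fun i => heJ _
  refine ⟨x, y, Finset.univ.filter fun p => Kept I ω (ℓ (x p.1) (y p.2)) (x p.1) ∧
    Kept I ω (ℓ (x p.1) (y p.2)) (y p.2), ⟨hx, hy, hxy, ?_⟩, ?_, ?_⟩
  · intro p hp q hq hpq
    simp only [Finset.coe_filter, Finset.mem_univ, true_and, Set.mem_ofPred_eq] at hp hq hpq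
    rw [← hpq] at hq
    refine Prod.ext (hx ?_) (hy ?_)
    · have := h3 _ _ (hxJ p.1) _ (hxJ q.1) _ (hyJ p.2) hp.1 hq.1 hp.2
      simpa [hxy] using this
    · have := h3 _ _ (hyJ p.2) _ (hyJ q.2) _ (hxJ p.1) hp.2 hq.2 hp.1
      simpa [(hxy _ _).symm] using this
  · intro p hp
    simp only [Finset.mem_filter, Finset.mem_univ, true_and] at hp
    exact ⟨hp.1.2.1, hp.1.2.2, hp.2.2.2⟩
  · intro p hp
    simp only [Finset.mem_filter, Finset.mem_univ, true_and] at hp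
    exact sampleGraph_adj_cases hℓ (hJ (hxJ _) (hyJ _) (hxy _ _)) hp

open Classical in
/-- A clique with many points kept on a line `L`, and `r` points not kept on it, contains a complete
bipartite pattern between these `r` points and points kept on `L`. -/
theorem exists_joined_of_line (hℓ : ∀ v w l, v ≠ w → I l v → I l w → ℓ v w = l) {K : Finset V}
    (hK : (sampleGraph I ω).IsClique K) {k r : ℕ} {L : Λ}
    (hL : k + r ^ 2 ≤ (K.filter (Kept I ω L)).card)
    (hr : r ≤ (K.filter fun v => ¬ Kept I ω L v).card) :
    ∃ (x : Fin r → V) (y : Fin k → V) (T : Finset (Fin r × Fin k)), IsGeneric ℓ x y T ∧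
      IsJoined ω ℓ x y T ∧ (∀ p ∈ T, ℓ (x p.1) (y p.2) ≠ L) ∧ ∀ i, Kept I ω L (y i) := by
  obtain ⟨X, hXK, hX⟩ := Finset.exists_subset_card_eq hr
  set x : Fin r → V := fun i => (X.equivFinOfCardEq hX).symm i
  have hx : Function.Injective x := fun i k h => (Equiv.injective _) (Subtype.ext h)
  have hxK : ∀ i, x i ∈ K ∧ ¬ Kept I ω L (x i) := fun i => by
    simpa using hXK ((X.equivFinOfCardEq hX).symm i).2
  -- `Z` collects the points of `L` on a line through two of the `x i`; each such line, being
  -- different from `L`, contributes at most one point.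
  set Z := Finset.univ.biUnion fun p : Fin r × Fin r => (K.filter (Kept I ω L)).filter fun v =>
    ℓ (x p.1) (x p.2) ≠ L ∧ I (ℓ (x p.1) (x p.2)) v with hZ
  have hZc : Z.card ≤ r ^ 2 := by
    refine Finset.card_biUnion_le.trans ((Finset.sum_le_card_nsmul _ _ 1 ?_).trans ?_)
    · intro p _
      rw [Finset.card_le_one]
      intro v hv w hw
      by_contra hne
      simp only [Finset.mem_filter] at hv hw
      exact hv.2.1 ((hℓ v w _ hne hv.2.2 hw.2.2).symm.trans (hℓ v w L hne hv.1.2.1 hw.1.2.1))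
    · simp [sq]
  have hk : k ≤ (K.filter (Kept I ω L) \ Z).card := by
    have := Finset.le_card_sdiff Z (K.filter (Kept I ω L))
    omega
  obtain ⟨Y, hYK, hY⟩ := Finset.exists_subset_card_eq hk
  set y : Fin k → V := fun i => (Y.equivFinOfCardEq hY).symm i
  have hy : Function.Injective y := fun i k h => (Equiv.injective _) (Subtype.ext h)
  have hyK : ∀ i, y i ∈ K ∧ Kept I ω L (y i) := fun i => by
    simpa using (Finset.mem_sdiff.1 (hYK ((Y.equivFinOfCardEq hY).symm i).2)).1
  have hyZ : ∀ i, y i ∉ Z := fun i =>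
    (Finset.mem_sdiff.1 (hYK ((Y.equivFinOfCardEq hY).symm i).2)).2
  have hxy : ∀ i k, x i ≠ y k := fun i k h => (hxK i).2 (h ▸ (hyK k).2)
  have hTL : ∀ i k, Kept I ω (ℓ (x i) (y k)) (x i) → ℓ (x i) (y k) ≠ L := fun i k h h' =>
    (hxK i).2 (h' ▸ h)
  refine ⟨x, y, Finset.univ.filter fun p => Kept I ω (ℓ (x p.1) (y p.2)) (x p.1) ∧
    Kept I ω (ℓ (x p.1) (y p.2)) (y p.2), ⟨hx, hy, hxy, ?_⟩, ⟨?_, ?_⟩, ?_, fun i => (hyK i).2⟩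
  · intro p hp q hq hpq
    simp only [Finset.coe_filter, Finset.mem_univ, true_and, Set.mem_ofPred_eq] at hp hq hpq
    have hpL := hTL _ _ hp.1
    rw [← hpq] at hq
    have h2 : y p.2 = y q.2 := by
      by_contra hne
      exact hpL ((hℓ _ _ _ hne hp.2.1 hq.2.1).symm.trans
        (hℓ _ _ L hne (hyK _).2.1 (hyK _).2.1))
    have h1 : x p.1 = x q.1 := by
      by_contra hne
      have h := hℓ _ _ _ hne hp.1.1 hq.1.1
      refine hyZ p.2 (Finset.mem_biUnion.2 ⟨(p.1, q.1), Finset.mem_univ _, ?_⟩)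
      rw [Finset.mem_filter, Finset.mem_filter, h]
      exact ⟨hyK _, hpL, hp.2.1⟩
    exact Prod.ext (hx h1) (hy h2)
  · intro p hp
    simp only [Finset.mem_filter, Finset.mem_univ, true_and] at hp
    exact ⟨hp.1.2.1, hp.1.2.2, hp.2.2.2⟩
  · intro p hp
    simp only [Finset.mem_filter, Finset.mem_univ, true_and] at hp
    exact sampleGraph_adj_cases hℓ (hK (hxK _).1 (hyK _).1 (hxy _ _)) hp
  · intro p hp
    simp only [Finset.mem_filter, Finset.mem_univ, true_and] at hp
    exact hTL _ _ hp.1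

/-- A clique with at least `s + r` points, large in terms of `j`, `k`, `r`, contains one of the two
patterns. In a maximal subset `J` without three points kept on a line, either `J` is large, or the
lines spanned by `J` cover the rest of the clique and one of them has many of its points; since at
most `s` points of the clique are kept on that line, `r` points remain outside. -/
theorem exists_joined_of_isClique (hℓ : ∀ v w l, v ≠ w → I l v → I l w → ℓ v w = l) {K : Finset V}
    (hK : (sampleGraph I ω).IsClique K) {j k r : ℕ}
    (hcard : 2 * j + (2 * j) ^ 2 * (k + r ^ 2) ≤ K.card) (hr : s + r ≤ K.card) :
    (∃ (x y : Fin j → V) (T : Finset (Fin j × Fin j)), IsGeneric ℓ x y T ∧ IsJoined ω ℓ x y T) ∨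
    ∃ (L : Λ) (x : Fin r → V) (y : Fin k → V) (T : Finset (Fin r × Fin k)), IsGeneric ℓ x y T ∧
      IsJoined ω ℓ x y T ∧ (∀ p ∈ T, ℓ (x p.1) (y p.2) ≠ L) ∧ ∀ i, Kept I ω L (y i) := by
  classical
  let NT : Finset V → Prop := fun J => ∀ l, ∀ u ∈ J, ∀ v ∈ J, ∀ w ∈ J,
    Kept I ω l u → Kept I ω l v → Kept I ω l w → u = v ∨ u = w ∨ v = w
  obtain ⟨J, hJ, hmax⟩ := Finset.exists_max_image (K.powerset.filter NT) Finset.card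
    ⟨∅, by simp [NT]⟩
  simp only [Finset.mem_filter, Finset.mem_powerset] at hJ hmax
  by_cases hj : 2 * j ≤ J.card
  · exact Or.inl (exists_joined_of_no_three hℓ (hK.subset (by exact_mod_cast hJ.1)) hj hJ.2)
  right
  have hline : ∃ L, k + r ^ 2 ≤ (K.filter (Kept I ω L)).card := by
    by_contra! hlt
    have hsub : K ⊆ J ∪ (J ×ˢ J).biUnion fun p => K.filter (Kept I ω (ℓ p.1 p.2)) := by
      intro z hz
      rw [Finset.mem_union]
      by_contra! hz'
      obtain ⟨hzJ, hzU⟩ := hz'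
      have hno : ∀ l, ∀ u ∈ J, ∀ v ∈ J, Kept I ω l u → Kept I ω l v → Kept I ω l z → u = v := by
        intro l u hu v hv h1 h2 h3
        by_contra hne
        refine hzU (Finset.mem_biUnion.2 ⟨(u, v), Finset.mem_product.2 ⟨hu, hv⟩, ?_⟩)
        rw [Finset.mem_filter, hℓ u v l hne h1.1 h2.1]
        exact ⟨hz, h3⟩
      have hins : NT (insert z J) := by
        intro l u hu v hv w hw h1 h2 h3
        rw [Finset.mem_insert] at hu hv hw
        rcases hu with rfl | hu <;> rcases hv with rfl | hv <;> rcases hw with rfl | hw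
        · simp
        · simp
        · simp
        · exact Or.inr (Or.inr (hno l v hv w hw h2 h3 h1))
        · simp
        · exact Or.inr (Or.inl (hno l u hu w hw h1 h3 h2))
        · exact Or.inl (hno l u hu v hv h1 h2 h3)
        · exact hJ.2 l u hu v hv w hw h1 h2 h3
      have := hmax _ ⟨Finset.insert_subset hz hJ.1, hins⟩
      rw [Finset.card_insert_of_notMem hzJ] at this
      omega
    have h1 := (Finset.card_le_card hsub).trans (Finset.card_union_le _ _)
    have h2 : ((J ×ˢ J).biUnion fun p => K.filter (Kept I ω (ℓ p.1 p.2))).card ≤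
        (J ×ˢ J).card * (k + r ^ 2) :=
      Finset.card_biUnion_le_card_mul _ _ _ fun p _ => (hlt _).le
    have h3 : (J ×ˢ J).card ≤ (2 * j) ^ 2 := by
      rw [Finset.card_product, ← sq]
      exact Nat.pow_le_pow_left (by omega) 2
    have h4 := Nat.mul_le_mul_right (k + r ^ 2) h3
    omega
  obtain ⟨L, hL⟩ := hline
  have h1 := card_filter_kept_le hℓ hK L
  have h2 := Finset.card_filter_add_card_filter_not (s := K) (Kept I ω L)
  exact ⟨L, exists_joined_of_line hℓ hK hL (by omega)⟩

end Clique

/-! ### Union bounds -/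

section UnionBound

theorem card_biUnion_mul_le {κ Ω : Type*} [DecidableEq Ω] (S : Finset κ) (E : κ → Finset Ω)
    {D W : ℝ} (hD : 0 ≤ D) (h : ∀ i ∈ S, ((E i).card : ℝ) * D ≤ W) :
    ((S.biUnion E).card : ℝ) * D ≤ S.card * W := by
  calc ((S.biUnion E).card : ℝ) * D ≤ (∑ i ∈ S, ((E i).card : ℝ)) * D := by
        gcongr
        exact_mod_cast Finset.card_biUnion_le
    _ = ∑ i ∈ S, ((E i).card : ℝ) * D := Finset.sum_mul ..
    _ ≤ S.card * W := by
        simpa using Finset.sum_le_card_nsmul S _ W h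

variable {V Λ : Type*} {P N M s : ℕ} [NeZero P] [NeZero N] [NeZero M]
  {ℓ : V → V → Λ}

theorem injective_sym2_of_isGeneric {a b : ℕ} {x : Fin a → V} {y : Fin b → V}
    {T : Finset (Fin a × Fin b)} (h : IsGeneric ℓ x y T) :
    Function.Injective fun p : Fin a × Fin b => s(x p.1, y p.2) := by
  intro p q hpq
  rcases Sym2.eq_iff.1 hpq with ⟨h1, h2⟩ | ⟨h1, -⟩
  · exact Prod.ext (h.left_injective h1) (h.right_injective h2)
  · exact absurd h1 (h.ne _ _)

variable [Fintype V] [Fintype Λ]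

open Classical in
/-- Union bound for the pattern without three points on a line. -/
theorem card_exists_joined_le (j : ℕ) {X : ℝ} (hX : 0 ≤ X) (hXP : X ≤ P * N ^ 2) (hXM : X ≤ M) :
    ((Finset.univ.filter fun ω : Sample V Λ P N M s => ∃ (x y : Fin j → V)
      (T : Finset (Fin j × Fin j)), IsGeneric ℓ x y T ∧ IsJoined ω ℓ x y T).card : ℝ) *
      X ^ (j * j) ≤
    Fintype.card V ^ (2 * j) * 2 ^ (j * j) * Fintype.card (Sample V Λ P N M s) := by
  set S : Finset ((Fin j → V) × (Fin j → V) × Finset (Fin j × Fin j)) :=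
    Finset.univ.filter fun t => IsGeneric ℓ t.1 t.2.1 t.2.2 with hS
  have hSc : (S.card : ℝ) ≤ Fintype.card V ^ (2 * j) * 2 ^ (j * j) := by
    refine (Nat.cast_le.2 (Finset.card_filter_le _ _)).trans (le_of_eq ?_)
    simp
    ring
  have hsub : (Finset.univ.filter fun ω : Sample V Λ P N M s => ∃ (x y : Fin j → V)
      (T : Finset (Fin j × Fin j)), IsGeneric ℓ x y T ∧ IsJoined ω ℓ x y T) ⊆
      S.biUnion fun t => Finset.univ.filter fun ω => IsJoined ω ℓ t.1 t.2.1 t.2.2 := by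
    intro ω hω
    obtain ⟨x, y, T, h1, h2⟩ := (Finset.mem_filter.1 hω).2
    exact Finset.mem_biUnion.2 ⟨(x, y, T), by simp [hS, h1], by simp [h2]⟩
  have hE : ∀ t ∈ S, ((Finset.univ.filter fun ω : Sample V Λ P N M s =>
      IsJoined ω ℓ t.1 t.2.1 t.2.2).card : ℝ) * X ^ (j * j) ≤
      Fintype.card (Sample V Λ P N M s) := by
    rintro ⟨x, y, T⟩ ht
    have hg : IsGeneric ℓ x y T := (Finset.mem_filter.1 ht).2
    have := card_pattern_le (P := P) (N := N) (M := M) (s := s)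
      (fun p : Fin j × Fin j => x p.1) (fun p => y p.2) (fun p => ℓ (x p.1) (y p.2)) T ∅
      (injective_sym2_of_isGeneric hg) (fun p => hg.ne _ _) hg.injOn (by simp) hX hXP hXM
    simpa [IsJoined] using this
  calc _ ≤ ((S.biUnion fun t => Finset.univ.filter fun ω : Sample V Λ P N M s =>
        IsJoined ω ℓ t.1 t.2.1 t.2.2).card : ℝ) * X ^ (j * j) := by gcongr
    _ ≤ S.card * Fintype.card (Sample V Λ P N M s) := card_biUnion_mul_le _ _ (by positivity) hE
    _ ≤ _ := by gcongr

open Classical in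
/-- Union bound for the pattern of `r` points joined to `k` points of a line. The selection of the
line itself is not used, the factor `N ^ k` comes from the points kept on it. -/
theorem card_exists_joined_line_le {I : Λ → V → Prop} {q : ℕ}
    (hq : ∀ L, (Finset.univ.filter (I L)).card ≤ q) (r k : ℕ) {X : ℝ} (hX : 0 ≤ X)
    (hXP : X ≤ P * N ^ 2) (hXM : X ≤ M) :
    ((Finset.univ.filter fun ω : Sample V Λ P N M s => ∃ (L : Λ) (x : Fin r → V) (y : Fin k → V)
      (T : Finset (Fin r × Fin k)), IsGeneric ℓ x y T ∧ IsJoined ω ℓ x y T ∧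
      (∀ p ∈ T, ℓ (x p.1) (y p.2) ≠ L) ∧ ∀ i, Kept I ω L (y i)).card : ℝ) *
      (X ^ (r * k) * N ^ k) ≤
    Fintype.card Λ * (Fintype.card V ^ r * q ^ k * 2 ^ (r * k)) *
      Fintype.card (Sample V Λ P N M s) := by
  set S : Finset (Σ _ : Λ, (Fin r → V) × (Fin k → V) × Finset (Fin r × Fin k)) :=
    (Finset.univ.sigma fun L => Finset.univ ×ˢ
      (Fintype.piFinset fun _ => Finset.univ.filter (I L)) ×ˢ Finset.univ).filter
    fun t => IsGeneric ℓ t.2.1 t.2.2.1 t.2.2.2 ∧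
      ∀ p ∈ t.2.2.2, ℓ (t.2.1 p.1) (t.2.2.1 p.2) ≠ t.1 with hS
  have hSc : (S.card : ℝ) ≤ Fintype.card Λ * (Fintype.card V ^ r * q ^ k * 2 ^ (r * k)) := by
    have h1 := Finset.card_filter_le (Finset.univ.sigma fun L : Λ =>
      (Finset.univ : Finset (Fin r → V)) ×ˢ (Fintype.piFinset fun _ : Fin k =>
        Finset.univ.filter (I L)) ×ˢ (Finset.univ : Finset (Finset (Fin r × Fin k))))
      fun t => IsGeneric ℓ t.2.1 t.2.2.1 t.2.2.2 ∧
        ∀ p ∈ t.2.2.2, ℓ (t.2.1 p.1) (t.2.2.1 p.2) ≠ t.1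
    rw [← hS, Finset.card_sigma] at h1
    have h2 : S.card ≤ ∑ _L : Λ, Fintype.card V ^ r * q ^ k * 2 ^ (r * k) := by
      refine h1.trans (Finset.sum_le_sum fun L _ => ?_)
      rw [Finset.card_product, Finset.card_product, Fintype.card_piFinset]
      simp only [Finset.card_univ, Fintype.card_pi, Finset.prod_const, Fintype.card_fin,
        Fintype.card_finset, Fintype.card_prod, mul_assoc]
      gcongr
      exact hq L
    simp only [Finset.sum_const, Finset.card_univ, smul_eq_mul] at h2
    exact_mod_cast h2
  have hsub : (Finset.univ.filter fun ω : Sample V Λ P N M s => ∃ (L : Λ) (x : Fin r → V)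
      (y : Fin k → V) (T : Finset (Fin r × Fin k)), IsGeneric ℓ x y T ∧ IsJoined ω ℓ x y T ∧
      (∀ p ∈ T, ℓ (x p.1) (y p.2) ≠ L) ∧ ∀ i, Kept I ω L (y i)) ⊆
      S.biUnion fun t => Finset.univ.filter fun ω => IsJoined ω ℓ t.2.1 t.2.2.1 t.2.2.2 ∧
        ∀ i, ((ω.1 t.1).2 (t.2.2.1 i)).1 = 0 := by
    intro ω hω
    obtain ⟨L, x, y, T, h1, h2, h3, h4⟩ := (Finset.mem_filter.1 hω).2
    refine Finset.mem_biUnion.2 ⟨⟨L, x, y, T⟩, ?_, ?_⟩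
    · simp only [hS, Finset.mem_filter, Finset.mem_sigma, Finset.mem_univ, Finset.mem_product,
        Fintype.mem_piFinset, true_and, and_true]
      exact ⟨fun i => (h4 i).1, h1, h3⟩
    · simp only [Finset.mem_filter, Finset.mem_univ, true_and]
      exact ⟨h2, fun i => (h4 i).2.2⟩
  have hE : ∀ t ∈ S, ((Finset.univ.filter fun ω : Sample V Λ P N M s =>
      IsJoined ω ℓ t.2.1 t.2.2.1 t.2.2.2 ∧ ∀ i, ((ω.1 t.1).2 (t.2.2.1 i)).1 = 0).card : ℝ) *
      (X ^ (r * k) * N ^ k) ≤ Fintype.card (Sample V Λ P N M s) := by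
    rintro ⟨L, x, y, T⟩ ht
    obtain ⟨hg, hL⟩ : IsGeneric ℓ x y T ∧ ∀ p ∈ T, ℓ (x p.1) (y p.2) ≠ L :=
      (Finset.mem_filter.1 ht).2
    have hc : (Finset.univ.image fun i => (L, y i)).card = k := by
      rw [Finset.card_image_of_injective _ fun i j h =>
        hg.right_injective (Prod.ext_iff.1 h).2]
      simp
    have := card_pattern_le (P := P) (N := N) (M := M) (s := s)
      (fun p : Fin r × Fin k => x p.1) (fun p => y p.2) (fun p => ℓ (x p.1) (y p.2)) T
      (Finset.univ.image fun i => (L, y i))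
      (injective_sym2_of_isGeneric hg) (fun p => hg.ne _ _) hg.injOn
      (by simpa using fun i j h _ => hL (i, j) h) hX hXP hXM
    simpa [IsJoined, hc, and_assoc] using this
  calc _ ≤ ((S.biUnion fun t => Finset.univ.filter fun ω : Sample V Λ P N M s =>
        IsJoined ω ℓ t.2.1 t.2.2.1 t.2.2.2 ∧ ∀ i, ((ω.1 t.1).2 (t.2.2.1 i)).1 = 0).card : ℝ) *
        (X ^ (r * k) * N ^ k) := by gcongr
    _ ≤ S.card * Fintype.card (Sample V Λ P N M s) := card_biUnion_mul_le _ _ (by positivity) hE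
    _ ≤ _ := by gcongr

open Classical in
/-- Two points are adjacent with probability at least `1 / (2 M)`: it suffices that their pair has
label `0` and the line through them, if there is one, is not selected. -/
theorem card_le_two_mul_card_adj {I : Λ → V → Prop}
    (hℓ : ∀ v w l, v ≠ w → I l v → I l w → ℓ v w = l) (hP : 2 ≤ P) {v w : V} (hvw : v ≠ w) :
    Fintype.card (Sample V Λ P N M s) ≤ 2 * M *
      (Finset.univ.filter fun ω : Sample V Λ P N M s => (sampleGraph I ω).Adj v w).card := by
  have h1 := card_sample_filter_eq_zero (P := P) (N := N) (M := M) (s := s) (V := V) (Λ := Λ)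
    ∅ ∅ {s(v, w)}
  have h2 := card_sample_filter_eq_zero (P := P) (N := N) (M := M) (s := s) (V := V) (Λ := Λ)
    {ℓ v w} ∅ {s(v, w)}
  simp only [Finset.notMem_empty, false_imp_iff, implies_true, Finset.mem_singleton, forall_eq,
    true_and, Finset.card_empty, pow_zero, one_mul, mul_one, Finset.card_singleton, pow_one] at h1 h2
  set A := Finset.univ.filter fun ω : Sample V Λ P N M s => ω.2 s(v, w) = 0
  set B := Finset.univ.filter fun ω : Sample V Λ P N M s =>
    (ω.1 (ℓ v w)).1 = 0 ∧ ω.2 s(v, w) = 0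
  have hsub : A \ B ⊆
      Finset.univ.filter fun ω : Sample V Λ P N M s => (sampleGraph I ω).Adj v w := by
    intro ω hω
    simp only [A, B, Finset.mem_sdiff, Finset.mem_filter, Finset.mem_univ, true_and,
      not_and] at hω ⊢
    refine ⟨hvw, Or.inr ⟨hω.1, fun l hv hw => ?_⟩⟩
    rw [← hℓ v w l hvw hv hw]
    exact fun h => hω.2 h hω.1
  have h3 := (Finset.le_card_sdiff B A).trans (Finset.card_le_card hsub)
  have h4 : 2 * (M * B.card) ≤ Fintype.card (Sample V Λ P N M s) := by
    rw [← h2]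
    nlinarith [Nat.mul_le_mul_right (M * B.card) hP]
  have h5 := Nat.mul_le_mul_left M (Nat.sub_le_iff_le_add.1 h3)
  rw [mul_add] at h5
  nlinarith

end UnionBound

/-! ### Rainbow lines -/

section Rainbow

open Classical in
theorem card_filter_forall_ne {V β : Type*} [Fintype V] [Fintype β] [Nonempty β] (W : Finset V)
    (c : β) : ((Finset.univ.filter fun h : V → β => ∀ v ∈ W, h v ≠ c).card : ℝ) =
      (1 - 1 / Fintype.card β) ^ W.card * Fintype.card (V → β) := by
  have hset : (Finset.univ.filter fun h : V → β => ∀ v ∈ W, h v ≠ c) =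
      Fintype.piFinset fun v => if v ∈ W then Finset.univ.erase c else Finset.univ := by
    ext h
    simp only [Finset.mem_filter, Finset.mem_univ, true_and, Fintype.mem_piFinset]
    refine forall_congr' fun v => ?_
    split_ifs with hv <;> simp [hv]
  have hβ : (Fintype.card β : ℝ) ≠ 0 := by exact_mod_cast Fintype.card_ne_zero
  rw [hset, Fintype.card_piFinset, Fintype.card_pi]
  push_cast
  have : (1 - 1 / (Fintype.card β : ℝ)) ^ W.card =
      ∏ v : V, if v ∈ W then (1 - 1 / (Fintype.card β : ℝ)) else 1 := by
    simp [Finset.prod_ite_mem, Finset.prod_const]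
  rw [this, ← Finset.prod_mul_distrib]
  refine Finset.prod_congr rfl fun v _ => ?_
  split_ifs
  · rw [Finset.card_erase_of_mem (Finset.mem_univ _), Finset.card_univ,
      Nat.cast_sub Fintype.card_pos]
    field_simp
    simp
  · simp

variable {V Λ : Type*} {P N M s : ℕ} [NeZero P] [NeZero N] [NeZero M]

/-- The line `l` is selected and the points of `U` kept on it show all `s` colours. -/
def IsRainbow (I : Λ → V → Prop) (ω : Sample V Λ P N M s) (U : Finset V) (l : Λ) : Prop :=
  (ω.1 l).1 = 0 ∧ ∀ c : Fin s, ∃ v ∈ U, I l v ∧ (ω.1 l).2 v = (0, c)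

theorem not_cliqueFree_of_isRainbow {I : Λ → V → Prop} {ω : Sample V Λ P N M s} {U : Finset V}
    {l : Λ} (h : IsRainbow I ω U l) :
    ¬ ((sampleGraph I ω).induce (U : Set V)).CliqueFree s := by
  obtain ⟨hl, h⟩ := h
  choose f hfU hfI hf using h
  rw [SimpleGraph.cliqueFree_iff]
  have hinj : Function.Injective f := fun c d hcd => by
    have h1 := hf c
    rw [hcd, hf d] at h1
    exact ((Prod.ext_iff.1 h1).2).symm
  refine fun hempty => hempty.elim' ⟨⟨fun c => ⟨f c, hfU c⟩, fun {c d} hcd => ?_⟩,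
    fun c d hcd => hinj (congrArg Subtype.val hcd)⟩
  refine ⟨fun hcd' => hcd.ne (hinj hcd'), Or.inl ⟨l, ⟨hfI c, hl, ?_⟩, ⟨hfI d, hl, ?_⟩, ?_⟩⟩
  · simp [hf]
  · simp [hf]
  · simpa [hf] using hcd.ne

/-- A rainbow line in every `u`-set bounds the `s`-independence number. -/
theorem sIndepNum_lt_of_isRainbow [Fintype V] {I : Λ → V → Prop} {ω : Sample V Λ P N M s} {u : ℕ}
    (hu : 0 < u) (h : ∀ U : Finset V, U.card = u → ∃ l, IsRainbow I ω U l) :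
    sIndepNum s (sampleGraph I ω) < u := by
  have hlt : ∀ k ∈ {k : ℕ | ∃ S : Finset V,
      ((sampleGraph I ω).induce (S : Set V)).CliqueFree s ∧ S.card = k}, k ≤ u - 1 := by
    rintro k ⟨S, hS, rfl⟩
    by_contra! hlt
    obtain ⟨U, hUS, hU⟩ := Finset.exists_subset_card_eq (show u ≤ S.card by omega)
    obtain ⟨l, hl⟩ := h U hU
    exact not_cliqueFree_of_isRainbow hl (hS.comap
      (SimpleGraph.induceHomOfLE (sampleGraph I ω) (by exact_mod_cast hUS)).isContained)
  have := csSup_le' (fun k hk => hlt k hk)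
  unfold sIndepNum
  omega

variable [Fintype Λ]

open Classical in
/-- Second moment method: since two points lie on at most one line, a set `U` of at least `q` points
has at least half of the average number `|U| / q` of points on a positive proportion of the lines. -/
theorem sq_le_eight_mul_card_rich {I : Λ → V → Prop} {ℓ : V → V → Λ} {q : ℕ} (hq : 0 < q)
    (hℓ : ∀ v w l, v ≠ w → I l v → I l w → ℓ v w = l) (hΛ : Fintype.card Λ = q ^ 2)
    (hdeg : ∀ v, (Finset.univ.filter fun l => I l v).card = q) {U : Finset V} (hU : q ≤ U.card)
    {w : ℕ} (hw : 2 * q * w ≤ U.card + 2 * q) :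
    q ^ 2 ≤ 8 * (Finset.univ.filter fun l => w ≤ (U.filter (I l)).card).card := by
  set d : Λ → ℕ := fun l => (U.filter (I l)).card with hd
  set G := Finset.univ.filter fun l => w ≤ d l with hG
  have hsum : ∑ l, d l = U.card * q := by
    have := Finset.sum_card_bipartiteAbove_eq_sum_card_bipartiteBelow (s := (Finset.univ : Finset Λ))
      (t := U) I
    simp only [Finset.bipartiteAbove, Finset.bipartiteBelow, hdeg] at this
    simpa [hd] using this
  have hsq : ∑ l, d l ^ 2 ≤ U.card * q + U.card ^ 2 := by
    have h1 : ∀ l, d l ^ 2 = ((U ×ˢ U).filter fun p => I l p.1 ∧ I l p.2).card := by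
      intro l
      rw [Finset.filter_product, Finset.card_product, sq]
    have h2 := Finset.sum_card_bipartiteAbove_eq_sum_card_bipartiteBelow
      (s := (Finset.univ : Finset Λ)) (t := U ×ˢ U) fun l p => I l p.1 ∧ I l p.2
    simp only [Finset.bipartiteAbove, Finset.bipartiteBelow, ← h1] at h2
    rw [h2, Finset.sum_product]
    have h3 : ∀ v ∈ U, ∑ x ∈ U, (Finset.univ.filter fun l => I l v ∧ I l x).card ≤
        q + U.card := by
      intro v hv
      rw [← Finset.add_sum_erase _ _ hv]
      refine Nat.add_le_add (by simp [hdeg]) ?_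
      refine (Finset.sum_le_card_nsmul _ _ 1 fun x hx => ?_).trans ?_
      · rw [Finset.card_le_one]
        intro l hl m hm
        simp only [Finset.mem_filter, Finset.mem_univ, true_and] at hl hm
        have hne := (Finset.ne_of_mem_erase hx).symm
        rw [← hℓ v x l hne hl.1 hl.2, hℓ v x m hne hm.1 hm.2]
      · simpa using Finset.card_erase_le
    calc _ ≤ U.card * (q + U.card) := by simpa using Finset.sum_le_card_nsmul _ _ _ h3
      _ = _ := by ring
  have hsplit : ∑ l ∈ G, d l + ∑ l ∈ Finset.univ.filter (fun l => ¬ w ≤ d l), d l =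
      U.card * q := by
    rw [hG, Finset.sum_filter_add_sum_filter_not, hsum]
  have hpoor : 2 * ∑ l ∈ Finset.univ.filter (fun l => ¬ w ≤ d l), d l ≤ U.card * q := by
    have h1 : ∀ l ∈ Finset.univ.filter (fun l => ¬ w ≤ d l), 2 * q * d l ≤ U.card := by
      intro l hl
      have : d l + 1 ≤ w := by simpa [Nat.succ_le_iff] using (Finset.mem_filter.1 hl).2
      nlinarith
    have h2 := Finset.sum_le_card_nsmul _ _ _ h1
    rw [← Finset.mul_sum, smul_eq_mul] at h2
    have h3 : (Finset.univ.filter (fun l => ¬ w ≤ d l)).card ≤ q ^ 2 := hΛ ▸ Finset.card_le_univ _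
    have h4 := h2.trans (Nat.mul_le_mul_right _ h3)
    refine Nat.le_of_mul_le_mul_left ?_ hq
    nlinarith
  have hCS : (∑ l ∈ G, d l) ^ 2 ≤ G.card * (2 * U.card ^ 2) := by
    refine sq_sum_le_card_mul_sum_sq.trans (Nat.mul_le_mul_left _ ?_)
    refine (Finset.sum_le_sum_of_subset (Finset.subset_univ G)).trans (hsq.trans ?_)
    nlinarith
  have hrich : U.card * q ≤ 2 * ∑ l ∈ G, d l := by omega
  have hpos : 0 < U.card ^ 2 := by have : 0 < U.card := by omega
                                   positivity
  refine Nat.le_of_mul_le_mul_left ?_ hpos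
  nlinarith [Nat.pow_le_pow_left hrich 2]

variable [Fintype V]

open Classical in
/-- The labels on a single line: if `W` is the set of points of `U` on it and is large, then the line
is rainbow for `U` with probability at least `1 / (2 P)`. -/
theorem card_line_not_rainbow_le [NeZero s] (W : Finset V) {w : ℕ} (hw : w ≤ W.card)
    (hs : (s : ℝ) * (1 - 1 / (N * s)) ^ w ≤ 1 / 2)
    (S : Finset (Fin P × (V → Fin N × Fin s)))
    (hS : ∀ g ∈ S, ¬ (g.1 = 0 ∧ ∀ c : Fin s, ∃ v ∈ W, g.2 v = (0, c))) :
    (S.card : ℝ) ≤ (1 - 1 / (2 * P)) * Fintype.card (Fin P × (V → Fin N × Fin s)) := by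
  set H : Finset (V → Fin N × Fin s) := Finset.univ.biUnion fun c : Fin s =>
    Finset.univ.filter fun h => ∀ v ∈ W, h v ≠ (0, c)
  have hN : (1 : ℝ) ≤ N := by exact_mod_cast NeZero.one_le
  have hs1 : (1 : ℝ) ≤ s := by exact_mod_cast NeZero.one_le
  have hNs : (0 : ℝ) ≤ 1 - 1 / (N * s) := by
    rw [sub_nonneg, div_le_one (by positivity)]
    nlinarith
  have hP : (0 : ℝ) < P := by exact_mod_cast NeZero.pos P
  have hH : (H.card : ℝ) ≤ 1 / 2 * Fintype.card (V → Fin N × Fin s) := by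
    calc (H.card : ℝ) ≤ ∑ c : Fin s, ((Finset.univ.filter fun h : V → Fin N × Fin s =>
          ∀ v ∈ W, h v ≠ (0, c)).card : ℝ) := by exact_mod_cast Finset.card_biUnion_le
      _ = s * ((1 - 1 / (N * s)) ^ W.card * Fintype.card (V → Fin N × Fin s)) := by
          have hc : ∀ c : Fin s, ((Finset.univ.filter fun h : V → Fin N × Fin s =>
              ∀ v ∈ W, h v ≠ (0, c)).card : ℝ) =
              (1 - 1 / Fintype.card (Fin N × Fin s)) ^ W.card *
                Fintype.card (V → Fin N × Fin s) := fun c => by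
            convert card_filter_forall_ne W ((0, c) : Fin N × Fin s)
          rw [Finset.sum_congr rfl fun c _ => hc c]
          simp
      _ ≤ s * ((1 - 1 / (N * s)) ^ w * Fintype.card (V → Fin N × Fin s)) := by
          gcongr ?_ * (?_ * _)
          refine pow_le_pow_of_le_one hNs ?_ hw
          linarith [show (0 : ℝ) ≤ 1 / (N * s) by positivity]
      _ ≤ _ := by
          rw [← mul_assoc]
          gcongr
  have hdisj : Disjoint S (({0} : Finset (Fin P)) ×ˢ (Finset.univ \ H)) := by
    rw [Finset.disjoint_left]
    intro g hg hg'
    rw [Finset.mem_product, Finset.mem_singleton] at hg'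
    exact hS g hg ⟨hg'.1, by simpa [H] using hg'.2⟩
  have h1 := Finset.card_le_univ (S ∪ ({0} : Finset (Fin P)) ×ˢ (Finset.univ \ H))
  rw [Finset.card_union_of_disjoint hdisj, Finset.card_product, Finset.card_singleton, one_mul,
    Finset.card_univ_sdiff] at h1
  have h2 : (S.card : ℝ) + (Fintype.card (V → Fin N × Fin s) - H.card) ≤
      Fintype.card (Fin P × (V → Fin N × Fin s)) := by
    rw [← Nat.cast_sub (Finset.card_le_univ H)]
    exact_mod_cast h1
  rw [Fintype.card_prod, Fintype.card_fin] at h2 ⊢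
  push_cast at h2 hH ⊢
  have h3 : (1 - 1 / (2 * (P : ℝ))) * (P * ∏ _v : V, ((N : ℝ) * s)) =
      P * (∏ _v : V, ((N : ℝ) * s)) - 1 / 2 * ∏ _v : V, ((N : ℝ) * s) := by
    field_simp
  simp only [Fintype.card_pi, Fintype.card_prod, Fintype.card_fin, Nat.cast_prod,
    Nat.cast_mul] at h2 hH h3 ⊢
  linarith

open Classical in
/-- The labels on different lines are independent, so `g` lines with many points of `U` all fail to
be rainbow with probability at most `(1 - 1 / (2 P)) ^ g`. -/
theorem card_no_rainbow_le [NeZero s] {I : Λ → V → Prop} (U : Finset V) {w g : ℕ}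
    (hs : (s : ℝ) * (1 - 1 / (N * s)) ^ w ≤ 1 / 2)
    (hg : g ≤ (Finset.univ.filter fun l => w ≤ (U.filter (I l)).card).card) :
    ((Finset.univ.filter fun ω : Sample V Λ P N M s => ∀ l, ¬ IsRainbow I ω U l).card : ℝ) ≤
      (1 - 1 / (2 * P)) ^ g * Fintype.card (Sample V Λ P N M s) := by
  set G := Finset.univ.filter fun l => w ≤ (U.filter (I l)).card with hG
  set F : Λ → Finset (Fin P × (V → Fin N × Fin s)) := fun l => Finset.univ.filter fun g =>
    ¬ (g.1 = 0 ∧ ∀ c : Fin s, ∃ v ∈ U.filter (I l), g.2 v = (0, c)) with hF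
  have hP : (1 : ℝ) ≤ P := by exact_mod_cast NeZero.one_le
  have hP0 : (0 : ℝ) ≤ 1 - 1 / (2 * P) := by
    rw [sub_nonneg, div_le_one (by positivity)]
    linarith
  have hP1 : 1 - 1 / (2 * (P : ℝ)) ≤ 1 := by
    linarith [show (0 : ℝ) ≤ 1 / (2 * P) by positivity]
  have hsub : (Finset.univ.filter fun ω : Sample V Λ P N M s => ∀ l, ¬ IsRainbow I ω U l) ⊆
      Fintype.piFinset F ×ˢ Finset.univ := by
    intro ω hω
    have hω' := (Finset.mem_filter.1 hω).2
    simp only [IsRainbow] at hω'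
    simp only [hF, Finset.mem_product, Fintype.mem_piFinset, Finset.mem_filter, Finset.mem_univ,
      true_and, and_true, and_assoc]
    exact hω'
  have hFc : ∀ l, ((F l).card : ℝ) ≤ (if l ∈ G then (1 - 1 / (2 * (P : ℝ))) else 1) *
      Fintype.card (Fin P × (V → Fin N × Fin s)) := by
    intro l
    split_ifs with hl
    · exact card_line_not_rainbow_le _ (Finset.mem_filter.1 hl).2 hs _
        fun g hg => (Finset.mem_filter.1 hg).2
    · rw [one_mul]
      exact_mod_cast Finset.card_le_univ _
  calc ((Finset.univ.filter fun ω : Sample V Λ P N M s => ∀ l, ¬ IsRainbow I ω U l).card : ℝ)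
      ≤ ((Fintype.piFinset F ×ˢ (Finset.univ : Finset (Sym2 V → Fin M))).card : ℝ) := by
        exact_mod_cast Finset.card_le_card hsub
    _ = (∏ l, ((F l).card : ℝ)) * Fintype.card (Sym2 V → Fin M) := by
        rw [Finset.card_product, Fintype.card_piFinset, Finset.card_univ]
        push_cast
        rfl
    _ ≤ (∏ l, (if l ∈ G then (1 - 1 / (2 * (P : ℝ))) else 1) *
          (Fintype.card (Fin P × (V → Fin N × Fin s)) : ℝ)) * Fintype.card (Sym2 V → Fin M) := by
        gcongr with l _
        exact hFc l
    _ = (1 - 1 / (2 * P)) ^ G.card * Fintype.card (Sample V Λ P N M s) := by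
        rw [Finset.prod_mul_distrib, Fintype.card_prod (Λ → _), Fintype.card_pi (ι := Λ)]
        push_cast
        simp only [Finset.prod_ite_mem, Finset.univ_inter, Finset.prod_const, mul_assoc]
    _ ≤ _ := by
        gcongr ?_ * _
        exact pow_le_pow_of_le_one hP0 hP1 hg

open Classical in
theorem card_exists_no_rainbow_le [NeZero s] {I : Λ → V → Prop} {u w g : ℕ}
    (hs : (s : ℝ) * (1 - 1 / (N * s)) ^ w ≤ 1 / 2)
    (hg : ∀ U : Finset V, U.card = u →
      g ≤ (Finset.univ.filter fun l => w ≤ (U.filter (I l)).card).card) :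
    ((Finset.univ.filter fun ω : Sample V Λ P N M s =>
      ∃ U : Finset V, U.card = u ∧ ∀ l, ¬ IsRainbow I ω U l).card : ℝ) ≤
      Fintype.card V ^ u * ((1 - 1 / (2 * P)) ^ g * Fintype.card (Sample V Λ P N M s)) := by
  have hP : (1 : ℝ) ≤ P := by exact_mod_cast NeZero.one_le
  have hP0 : (0 : ℝ) ≤ 1 - 1 / (2 * P) := by
    rw [sub_nonneg, div_le_one (by positivity)]
    linarith
  have hsub : (Finset.univ.filter fun ω : Sample V Λ P N M s =>
      ∃ U : Finset V, U.card = u ∧ ∀ l, ¬ IsRainbow I ω U l) ⊆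
      (Finset.univ.powersetCard u).biUnion fun U : Finset V =>
        Finset.univ.filter fun ω : Sample V Λ P N M s => ∀ l, ¬ IsRainbow I ω U l := by
    intro ω hω
    obtain ⟨U, hU, h⟩ := (Finset.mem_filter.1 hω).2
    exact Finset.mem_biUnion.2 ⟨U, by simp [Finset.mem_powersetCard, hU], by simpa using h⟩
  have h1 := card_biUnion_mul_le (Finset.univ.powersetCard u) (fun U : Finset V =>
    Finset.univ.filter fun ω : Sample V Λ P N M s => ∀ l, ¬ IsRainbow I ω U l) zero_le_one
    (W := (1 - 1 / (2 * P)) ^ g * Fintype.card (Sample V Λ P N M s)) (fun U hU => by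
      rw [mul_one]
      exact card_no_rainbow_le U hs (hg U (Finset.mem_powersetCard.1 hU).2))
  rw [mul_one, Finset.card_powersetCard, Finset.card_univ] at h1
  calc _ ≤ _ := Nat.cast_le.2 (Finset.card_le_card hsub)
    _ ≤ _ := h1
    _ ≤ _ := by
      gcongr
      exact_mod_cast Nat.choose_le_pow (Fintype.card V) u

end Rainbow

/-! ### Existence of a good sample -/

section Existence

variable {V Λ : Type*} [Fintype V] [Fintype Λ]

open Classical in
theorem card_mul_le_sum_card_adj {P N M s : ℕ} [NeZero P] [NeZero N] [NeZero M]
    {I : Λ → V → Prop} {ℓ : V → V → Λ}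
    (hℓ : ∀ v w l, v ≠ w → I l v → I l w → ℓ v w = l) (hP : 2 ≤ P) :
    Fintype.card V * (Fintype.card V - 1) * Fintype.card (Sample V Λ P N M s) ≤
      2 * M * ∑ ω : Sample V Λ P N M s,
        (Finset.univ.filter fun p : V × V => (sampleGraph I ω).Adj p.1 p.2).card := by
  have h1 := Finset.sum_card_bipartiteAbove_eq_sum_card_bipartiteBelow
    (s := (Finset.univ : Finset (Sample V Λ P N M s))) (t := (Finset.univ : Finset (V × V)))
    fun ω p => (sampleGraph I ω).Adj p.1 p.2
  simp only [Finset.bipartiteAbove, Finset.bipartiteBelow] at h1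
  rw [h1, Finset.mul_sum]
  calc _ = ∑ _p ∈ (Finset.univ : Finset V).offDiag, Fintype.card (Sample V Λ P N M s) := by
        rw [Finset.sum_const, Finset.offDiag_card, Finset.card_univ, smul_eq_mul, Nat.mul_sub_one]
    _ ≤ ∑ p ∈ (Finset.univ : Finset V).offDiag, 2 * M * (Finset.univ.filter fun
          ω : Sample V Λ P N M s => (sampleGraph I ω).Adj p.1 p.2).card :=
        Finset.sum_le_sum fun p hp =>
          card_le_two_mul_card_adj hℓ hP (Finset.mem_offDiag.1 hp).2.2
    _ ≤ _ := Finset.sum_le_sum_of_subset (Finset.subset_univ _)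

open Classical in
/-- Under numerical conditions bounding the three bad events, some sample avoids all of them and has
many edges. The bad events have total probability below `1 / (8 M)`, while the mean number of
adjacent ordered pairs is at least `n ^ 2 / (4 M)`. -/
theorem exists_graph_of_incidence {P N M s q r j k u w : ℕ} [NeZero N] [NeZero M] [NeZero s]
    {I : Λ → V → Prop} {ℓ : V → V → Λ} (hℓ : ∀ v w l, v ≠ w → I l v → I l w → ℓ v w = l)
    (hΛ : Fintype.card Λ = q ^ 2) (hdeg : ∀ v, (Finset.univ.filter fun l => I l v).card = q)
    (hline : ∀ L, (Finset.univ.filter (I L)).card ≤ q) (hP : 2 ≤ P) (hn : 2 ≤ Fintype.card V)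
    (hq : 0 < q) (hqu : q ≤ u) (hw : 2 * q * w ≤ u + 2 * q)
    (hs : (s : ℝ) * (1 - 1 / (N * s)) ^ w ≤ 1 / 2)
    (hcard : 2 * j + (2 * j) ^ 2 * (k + r ^ 2) ≤ s + r)
    {X : ℝ} (hX : 0 < X) (hXP : X ≤ P * N ^ 2) (hXM : X ≤ M)
    (hA : 32 * M * ((Fintype.card V : ℝ) ^ (2 * j) * 2 ^ (j * j)) ≤ X ^ (j * j))
    (hB : 32 * M * ((q : ℝ) ^ 2 * ((Fintype.card V : ℝ) ^ r * q ^ k * 2 ^ (r * k))) ≤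
      X ^ (r * k) * N ^ k)
    (hU : 32 * M * ((Fintype.card V : ℝ) ^ u * (1 - 1 / (2 * P)) ^ ((q ^ 2 + 7) / 8)) ≤ 1) :
    ∃ G : SimpleGraph V, G.CliqueFree (s + r) ∧ sIndepNum s G < u ∧
      (Fintype.card V : ℝ) ^ 2 ≤ 16 * M * G.edgeSet.ncard := by
  have : NeZero P := ⟨by omega⟩
  set n := Fintype.card V with hnV
  set W : ℝ := ((Fintype.card (Sample V Λ P N M s) : ℕ) : ℝ) with hWdef
  have hW : 0 < W := by
    have : Nonempty (Sample V Λ P N M s) := ⟨fun _ => (0, fun _ => (0, 0)), fun _ => 0⟩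
    exact Nat.cast_pos.2 Fintype.card_pos
  have hM : (0 : ℝ) < M := by exact_mod_cast NeZero.pos M
  have hN : (0 : ℝ) < N := by exact_mod_cast NeZero.pos N
  have hn2 : (2 : ℝ) ≤ n := by exact_mod_cast hn
  set A := Finset.univ.filter fun ω : Sample V Λ P N M s => ∃ (x y : Fin j → V)
      (T : Finset (Fin j × Fin j)), IsGeneric ℓ x y T ∧ IsJoined ω ℓ x y T with hAdef
  set B := Finset.univ.filter fun ω : Sample V Λ P N M s => ∃ (L : Λ) (x : Fin r → V)
      (y : Fin k → V) (T : Finset (Fin r × Fin k)), IsGeneric ℓ x y T ∧ IsJoined ω ℓ x y T ∧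
      (∀ p ∈ T, ℓ (x p.1) (y p.2) ≠ L) ∧ ∀ i, Kept I ω L (y i) with hBdef
  set C := Finset.univ.filter fun ω : Sample V Λ P N M s =>
      ∃ U : Finset V, U.card = u ∧ ∀ l, ¬ IsRainbow I ω U l with hCdef
  have bA : 32 * M * (A.card : ℝ) ≤ W := by
    have h := card_exists_joined_le (P := P) (N := N) (M := M) (s := s) (ℓ := ℓ) j hX.le hXP hXM
    refine le_of_mul_le_mul_right ?_ (pow_pos hX (j * j))
    calc 32 * M * (A.card : ℝ) * X ^ (j * j) = 32 * M * (A.card * X ^ (j * j)) := by ring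
      _ ≤ 32 * M * ((n : ℝ) ^ (2 * j) * 2 ^ (j * j) * W) := by gcongr
      _ = 32 * M * ((n : ℝ) ^ (2 * j) * 2 ^ (j * j)) * W := by ring
      _ ≤ X ^ (j * j) * W := by gcongr
      _ = _ := by ring
  have bB : 32 * M * (B.card : ℝ) ≤ W := by
    have h := card_exists_joined_line_le (P := P) (N := N) (M := M) (s := s) (ℓ := ℓ) hline r k
      hX.le hXP hXM
    rw [hΛ] at h
    push_cast at h
    refine le_of_mul_le_mul_right ?_ (show 0 < X ^ (r * k) * N ^ k by positivity)
    calc 32 * M * (B.card : ℝ) * (X ^ (r * k) * N ^ k) =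
          32 * M * (B.card * (X ^ (r * k) * N ^ k)) := by ring
      _ ≤ 32 * M * ((q : ℝ) ^ 2 * ((n : ℝ) ^ r * q ^ k * 2 ^ (r * k)) * W) := by gcongr
      _ = 32 * M * ((q : ℝ) ^ 2 * ((n : ℝ) ^ r * q ^ k * 2 ^ (r * k))) * W := by ring
      _ ≤ X ^ (r * k) * N ^ k * W := by gcongr
      _ = _ := by ring
  have bC : 32 * M * (C.card : ℝ) ≤ W := by
    have h := card_exists_no_rainbow_le (P := P) (N := N) (M := M) (I := I) (u := u)
      (g := (q ^ 2 + 7) / 8) hs (by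
        intro U hUc
        subst hUc
        have := sq_le_eight_mul_card_rich hq hℓ hΛ hdeg hqu hw
        omega)
    calc 32 * M * (C.card : ℝ) ≤
          32 * M * ((n : ℝ) ^ u * ((1 - 1 / (2 * P)) ^ ((q ^ 2 + 7) / 8) * W)) := by gcongr
      _ = 32 * M * ((n : ℝ) ^ u * (1 - 1 / (2 * P)) ^ ((q ^ 2 + 7) / 8)) * W := by ring
      _ ≤ 1 * W := by gcongr
      _ = W := one_mul W
  set d : Sample V Λ P N M s → ℕ := fun ω =>
    (Finset.univ.filter fun p : V × V => (sampleGraph I ω).Adj p.1 p.2).card with hd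
  have hdn : ∀ ω, (d ω : ℝ) ≤ (n : ℝ) ^ 2 := by
    intro ω
    have : d ω ≤ Fintype.card (V × V) := Finset.card_le_univ _
    rw [Fintype.card_prod, ← sq] at this
    exact_mod_cast this
  have hsum : (n : ℝ) ^ 2 * W ≤ 4 * M * ∑ ω, (d ω : ℝ) := by
    have h := card_mul_le_sum_card_adj (P := P) (N := N) (M := M) (s := s) hℓ hP
    have h' : (n : ℝ) * (n - 1) * W ≤ 2 * M * ∑ ω, (d ω : ℝ) := by
      have h'' := (Nat.cast_le (α := ℝ)).2 h
      rw [Nat.cast_mul, Nat.cast_mul, Nat.cast_sub (by omega), Nat.cast_mul, Nat.cast_mul,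
        Nat.cast_sum, Nat.cast_one, Nat.cast_ofNat] at h''
      exact h''
    nlinarith [mul_nonneg (mul_nonneg (by linarith : (0 : ℝ) ≤ n) hW.le) (sub_nonneg.2 hn2)]
  obtain ⟨ω, hω, hdω⟩ : ∃ ω, ω ∉ A ∪ B ∪ C ∧ (n : ℝ) ^ 2 ≤ 8 * M * d ω := by
    by_contra! hcon
    have h1 : ∑ ω, 8 * M * (d ω : ℝ) ≤
        ∑ ω, ((n : ℝ) ^ 2 + if ω ∈ A ∪ B ∪ C then 8 * M * (n : ℝ) ^ 2 else 0) := by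
      refine Finset.sum_le_sum fun ω _ => ?_
      split_ifs with h
      · have := mul_le_mul_of_nonneg_left (hdn ω) (show (0 : ℝ) ≤ 8 * M by positivity)
        nlinarith [sq_nonneg (n : ℝ)]
      · linarith [hcon ω h]
    rw [Finset.sum_add_distrib, ← Finset.mul_sum] at h1
    simp only [Finset.sum_ite_mem, Finset.univ_inter, Finset.sum_const, nsmul_eq_mul,
      Finset.card_univ] at h1
    have h2 : ((A ∪ B ∪ C).card : ℝ) ≤ A.card + B.card + C.card := by
      exact_mod_cast (Finset.card_union_le _ _).trans
        (Nat.add_le_add_right (Finset.card_union_le _ _) _)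
    have h3 : 32 * M * ((A ∪ B ∪ C).card : ℝ) ≤ 3 * W := by
      have := mul_le_mul_of_nonneg_left h2 (show (0 : ℝ) ≤ 32 * M by positivity)
      linarith
    have h4 : 0 < (n : ℝ) ^ 2 := by positivity
    have h5 := mul_le_mul_of_nonneg_right h3 h4.le
    have h6 := mul_pos hW h4
    rw [← hWdef] at h1
    linarith
  simp only [hAdef, hBdef, hCdef, Finset.mem_union, Finset.mem_filter, Finset.mem_univ, true_and,
    not_or] at hω
  obtain ⟨⟨hωA, hωB⟩, hωC⟩ := hω
  refine ⟨sampleGraph I ω, ?_, ?_, ?_⟩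
  · intro K hK
    rcases exists_joined_of_isClique (j := j) (k := k) (r := r) hℓ hK.isClique
      (by rw [hK.card_eq]; exact hcard) hK.card_eq.ge with h | h
    · exact hωA h
    · exact hωB h
  · refine sIndepNum_lt_of_isRainbow (I := I) (by omega) fun U hUc => ?_
    by_contra! h
    exact hωC ⟨U, hUc, h⟩
  · have h1 : 2 * (sampleGraph I ω).edgeSet.ncard = d ω := by
      rw [← SimpleGraph.coe_edgeFinset, Set.ncard_coe_finset,
        SimpleGraph.two_mul_card_edgeFinset]
    have h2 : (2 : ℝ) * (sampleGraph I ω).edgeSet.ncard = d ω := by exact_mod_cast h1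
    rw [← h2] at hdω
    linarith

end Existence

/-! ### Points and lines over a prime field -/

section AffinePlane

open Classical in
/-- The incidences of `n ≤ q ^ 2` points of the affine plane over `ZMod q` with the `q ^ 2` lines
`y = a x + b`; the vertical lines are left out, so some pairs of points lie on no line. -/
theorem exists_incidence {q n : ℕ} [Fact q.Prime] (hn : n ≤ q ^ 2) :
    ∃ (I : ZMod q × ZMod q → Fin n → Prop) (ℓ : Fin n → Fin n → ZMod q × ZMod q),
      (∀ v w l, v ≠ w → I l v → I l w → ℓ v w = l) ∧
      (∀ v, (Finset.univ.filter fun l => I l v).card = q) ∧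
      ∀ L, (Finset.univ.filter (I L)).card ≤ q := by
  obtain ⟨φ⟩ : Nonempty (Fin n ↪ ZMod q × ZMod q) := by
    refine Function.Embedding.nonempty_of_card_le ?_
    simpa [ZMod.card, ← sq] using hn
  obtain ⟨I, hI⟩ : ∃ I : ZMod q × ZMod q → Fin n → Prop,
      ∀ l v, I l v ↔ (φ v).2 = l.1 * (φ v).1 + l.2 := ⟨_, fun _ _ => Iff.rfl⟩
  have huniq : ∀ v w l m, v ≠ w → I l v → I l w → I m v → I m w → l = m := by
    intro v w l m hvw h1 h2 h3 h4
    simp only [hI] at h1 h2 h3 h4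
    have hx : (φ v).1 ≠ (φ w).1 := fun hx => hvw (φ.injective (Prod.ext hx (by
      rw [h1, h2, hx])))
    have h5 : (l.1 - m.1) * ((φ v).1 - (φ w).1) = 0 := by linear_combination h3 - h1 + h2 - h4
    have h6 : l.1 = m.1 := by
      rcases mul_eq_zero.1 h5 with h | h
      · exact sub_eq_zero.1 h
      · exact absurd (sub_eq_zero.1 h) hx
    refine Prod.ext h6 ?_
    rw [h6] at h1
    linear_combination h3 - h1
  refine ⟨I, fun v w => if h : ∃ l, I l v ∧ I l w then h.choose else 0, ?_, ?_, ?_⟩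
  · intro v w l hvw h1 h2
    have h : ∃ l, I l v ∧ I l w := ⟨l, h1, h2⟩
    simp only [h, dite_true]
    exact huniq v w _ _ hvw h.choose_spec.1 h.choose_spec.2 h1 h2
  · intro v
    have : (Finset.univ.filter fun l => I l v) =
        Finset.univ.image fun a : ZMod q => (a, (φ v).2 - a * (φ v).1) := by
      ext l
      simp only [hI, Finset.mem_filter, Finset.mem_univ, true_and, Finset.mem_image]
      constructor
      · exact fun h => ⟨l.1, Prod.ext rfl (by rw [h]; ring)⟩
      · rintro ⟨a, rfl⟩
        ring
    rw [this, Finset.card_image_of_injective _ fun a b h => (Prod.ext_iff.1 h).1]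
    simp [ZMod.card]
  · intro L
    have h : Set.InjOn (fun v => (φ v).1) (Finset.univ.filter (I L)) := by
      intro v hv w hw hvw
      simp only [hI, Finset.coe_filter, Finset.mem_univ, true_and, Set.mem_ofPred_eq] at hv hw hvw
      exact φ.injective (Prod.ext hvw (by rw [hv, hw, hvw]))
    simpa [ZMod.card] using Finset.card_le_card_of_injOn _ (fun v _ => Finset.mem_univ _) h

end AffinePlane

/-! ### Choice of the parameters -/

section Parameters

theorem natCeil_rpow_le {x a : ℝ} (hx : 1 ≤ x) (ha : 0 ≤ a) : (⌈x ^ a⌉₊ : ℝ) ≤ 2 * x ^ a := by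
  have h1 := Real.one_le_rpow hx ha
  have h2 := Nat.ceil_lt_add_one (show 0 ≤ x ^ a by linarith)
  linarith

/-- The numerical condition for a line to be rainbow with probability at least `1 / 2` once it is
selected. -/
theorem mul_pow_le_half {N s w : ℕ} (hN : 0 < N) (hs : 0 < s)
    (hw : 2 * (s : ℝ) * (N * s) ≤ w) : (s : ℝ) * (1 - 1 / (N * s)) ^ w ≤ 1 / 2 := by
  have hN1 : (1 : ℝ) ≤ N := by exact_mod_cast hN
  have hs1 : (1 : ℝ) ≤ s := by exact_mod_cast hs
  have hexp : 2 * (s : ℝ) ≤ w * (1 / (N * s)) := by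
    rwa [mul_one_div, le_div_iff₀ (by positivity)]
  have hle : (1 - 1 / ((N : ℝ) * s)) ^ w ≤ Real.exp (-(2 * s)) := by
    have h0 : (0 : ℝ) ≤ 1 - 1 / (N * s) := by
      rw [sub_nonneg, div_le_one (by positivity)]
      nlinarith
    calc (1 - 1 / ((N : ℝ) * s)) ^ w ≤ Real.exp (-(1 / (N * s))) ^ w := by
          gcongr
          exact Real.one_sub_le_exp_neg _
      _ = Real.exp (-(w * (1 / (N * s)))) := by rw [← Real.exp_nat_mul]; ring_nf
      _ ≤ _ := Real.exp_le_exp.2 (by linarith)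
  calc (s : ℝ) * (1 - 1 / (N * s)) ^ w ≤ s * Real.exp (-(2 * s)) := by gcongr
    _ ≤ 1 / 2 := by
      rw [Real.exp_neg, ← div_eq_mul_inv, div_le_iff₀ (Real.exp_pos _)]
      linarith [Real.add_one_le_exp (2 * (s : ℝ))]

theorem joined_bound {x c m : ℝ} {j : ℕ} (hx1 : 1 ≤ x) (hm : m ≤ 2 * x)
    (hj : 2 * (j : ℝ) + 2 ≤ c * (j * j)) (hxj : 64 * 2 ^ (j * j) ≤ x) :
    32 * m * (x ^ (2 * j) * 2 ^ (j * j)) ≤ (x ^ c) ^ (j * j) := by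
  have hx : 0 < x := by linarith
  calc 32 * m * (x ^ (2 * j) * 2 ^ (j * j))
      ≤ 32 * (2 * x) * (x ^ (2 * j) * 2 ^ (j * j)) := by gcongr
    _ = (64 * 2 ^ (j * j)) * (x ^ (2 * j) * x) := by ring
    _ ≤ x * (x ^ (2 * j) * x) := by gcongr
    _ = x ^ (((2 * j + 2 : ℕ)) : ℝ) := by rw [Real.rpow_natCast]; ring
    _ ≤ x ^ (c * ((j * j : ℕ) : ℝ)) := by
      refine Real.rpow_le_rpow_of_exponent_le hx1 ?_
      push_cast
      exact hj
    _ = _ := by rw [Real.rpow_mul_natCast hx.le]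

theorem joined_line_bound {x c δ m N q : ℝ} {r k : ℕ} (hx1 : 1 ≤ x) (hm : m ≤ 2 * x)
    (hq0 : 0 ≤ q) (hq : q ≤ 4 * x ^ (1 / 2 : ℝ)) (hN : x ^ (δ - 1 / 2) ≤ N)
    (hk : r + 3 ≤ k * (c * r - (1 - δ))) (hxk : 1024 * 4 ^ k * 2 ^ (r * k) ≤ x) :
    32 * m * (q ^ 2 * (x ^ r * q ^ k * 2 ^ (r * k))) ≤ (x ^ c) ^ (r * k) * N ^ k := by
  have hx : 0 < x := by linarith
  calc 32 * m * (q ^ 2 * (x ^ r * q ^ k * 2 ^ (r * k)))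
      ≤ 32 * (2 * x) * ((4 * x ^ (1 / 2 : ℝ)) ^ 2 * (x ^ r *
          (4 * x ^ (1 / 2 : ℝ)) ^ k * 2 ^ (r * k))) := by gcongr
    _ = (1024 * 4 ^ k * 2 ^ (r * k)) * (x * x ^ r * (x ^ (1 / 2 : ℝ)) ^ 2 *
          (x ^ (1 / 2 : ℝ)) ^ k) := by rw [mul_pow, mul_pow]; ring
    _ ≤ x * (x * x ^ r * (x ^ (1 / 2 : ℝ)) ^ 2 * (x ^ (1 / 2 : ℝ)) ^ k) := by gcongr
    _ = x ^ (3 + r + 1 / 2 * k : ℝ) := by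
      rw [← Real.rpow_mul_natCast hx.le, ← Real.rpow_mul_natCast hx.le, Real.rpow_add hx,
        Real.rpow_add hx, Real.rpow_natCast]
      norm_num
      ring
    _ ≤ x ^ (c * ((r * k : ℕ) : ℝ) + (δ - 1 / 2) * k) := by
      refine Real.rpow_le_rpow_of_exponent_le hx1 ?_
      push_cast
      linarith
    _ = (x ^ c) ^ (r * k) * (x ^ (δ - 1 / 2)) ^ k := by
      rw [Real.rpow_add hx, Real.rpow_mul_natCast hx.le, Real.rpow_mul_natCast hx.le]
    _ ≤ _ := by gcongr

theorem rainbow_bound {x δ ε m P C : ℝ} {u g : ℕ} (hx : 64 ≤ x) (hδ : 0 ≤ δ) (hm : m ≤ 2 * x)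
    (hP1 : 1 ≤ P) (hP : P ≤ 2 * x ^ (1 - δ - ε)) (hg : x ≤ 8 * g) (hu : u ≤ C * x ^ δ)
    (hlog : (C + 2) * Real.log x ≤ x ^ ε / 32) :
    32 * m * (x ^ u * (1 - 1 / (2 * P)) ^ g) ≤ 1 := by
  have hx0 : 0 < x := by linarith
  have hPn : x ^ (δ + ε) / 32 ≤ g * (1 / (2 * P)) := by
    rw [mul_one_div, div_le_div_iff₀ (by norm_num) (by positivity)]
    calc x ^ (δ + ε) * (2 * P) ≤ x ^ (δ + ε) * (2 * (2 * x ^ (1 - δ - ε))) := by gcongr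
      _ = 4 * (x ^ (δ + ε) * x ^ (1 - δ - ε)) := by ring
      _ = 4 * x := by
        rw [← Real.rpow_add hx0, show δ + ε + (1 - δ - ε) = 1 by ring, Real.rpow_one]
      _ ≤ _ := by linarith
  have hlog0 : 0 ≤ Real.log x := Real.log_nonneg (by linarith)
  have hδ0 : 1 ≤ x ^ δ := Real.one_le_rpow (by linarith) hδ
  have hlog' : (u + 2) * Real.log x ≤ x ^ (δ + ε) / 32 := by
    calc (u + 2) * Real.log x ≤ ((C + 2) * x ^ δ) * Real.log x := by
          gcongr
          linarith
      _ = x ^ δ * ((C + 2) * Real.log x) := by ring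
      _ ≤ x ^ δ * (x ^ ε / 32) := by gcongr
      _ = _ := by rw [Real.rpow_add hx0]; ring
  have h1P : (1 : ℝ) / (2 * P) ≤ 1 := by
    rw [div_le_one (by positivity)]
    linarith
  have hpow : (1 - 1 / (2 * P)) ^ g ≤ (x ^ (u + 2))⁻¹ := by
    calc (1 - 1 / (2 * P)) ^ g ≤ Real.exp (-(1 / (2 * P))) ^ g := by
          gcongr
          exact Real.one_sub_le_exp_neg _
      _ = Real.exp (-(g * (1 / (2 * P)))) := by rw [← Real.exp_nat_mul]; ring_nf
      _ ≤ Real.exp (-((u + 2) * Real.log x)) := Real.exp_le_exp.2 (by linarith)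
      _ = (x ^ (u + 2))⁻¹ := by
        rw [Real.exp_neg, mul_comm, Real.exp_mul, Real.exp_log hx0]
        norm_cast
  have h0 : 0 ≤ (1 - 1 / (2 * P)) ^ g := pow_nonneg (by linarith) _
  calc 32 * m * (x ^ u * (1 - 1 / (2 * P)) ^ g)
      ≤ 32 * (2 * x) * (x ^ u * (x ^ (u + 2))⁻¹) := by gcongr
    _ = 64 / x := by
      field_simp
      ring
    _ ≤ 1 := by rwa [div_le_one hx0]

/-- The random graph with `P ≈ n ^ (1 - δ - ε)`, `N ≈ n ^ (δ - 1 / 2)` and `M ≈ n ^ c`. -/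
theorem exists_graph_of_large {δ ε c : ℝ} {r j k s n : ℕ} (hδ : 1 / 2 ≤ δ) (hε : 0 < ε)
    (hεδ : ε < 1 - δ) (hc : 0 < c) (hcδ : c ≤ δ - ε) (hs0 : 0 < s)
    (hj : 2 * (j : ℝ) + 2 ≤ c * (j * j)) (hk : r + 3 ≤ k * (c * r - (1 - δ)))
    (hcard : 2 * j + (2 * j) ^ 2 * (k + r ^ 2) ≤ s + r)
    (hn2 : 2 ≤ n) (hnA : 64 * 2 ^ (j * j) ≤ n) (hnB : 1024 * 4 ^ k * 2 ^ (r * k) ≤ n)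
    (hnU : (32 * (s : ℝ) ^ 2 + 7) * Real.log n ≤ (n : ℝ) ^ ε / 32) :
    ∃ G : SimpleGraph (Fin n), G.CliqueFree (s + r) ∧
      (sIndepNum s G : ℝ) < (32 * (s : ℝ) ^ 2 + 4) * (n : ℝ) ^ δ ∧
      (n : ℝ) ^ (2 - c) ≤ 32 * G.edgeSet.ncard := by
  classical
  have hx2 : (2 : ℝ) ≤ n := by exact_mod_cast hn2
  have hx1 : (1 : ℝ) ≤ n := by linarith
  have hx : (0 : ℝ) < n := by linarith
  have hc1 : c ≤ 1 := by linarith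
  have hsR : (1 : ℝ) ≤ s := by exact_mod_cast hs0
  -- Bertrand's postulate supplies a prime `q` with `n ≤ q ^ 2 ≤ 16 n`.
  obtain ⟨q, hqp, hq1, hq2⟩ := Nat.exists_prime_lt_and_le_two_mul (Nat.sqrt n + 1) (by omega)
  have : Fact q.Prime := ⟨hqp⟩
  have hnq : n ≤ q ^ 2 := by
    have h1 := Nat.lt_succ_sqrt' n
    have h2 := Nat.pow_le_pow_left hq1.le 2
    rw [Nat.succ_eq_add_one] at h1
    omega
  have hq4 : (q : ℝ) ≤ 4 * (n : ℝ) ^ (1 / 2 : ℝ) := by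
    rw [← Real.sqrt_eq_rpow]
    have h1 : 1 ≤ Real.sqrt n := Real.one_le_sqrt.2 hx1
    have h2 : (Nat.sqrt n : ℝ) ≤ Real.sqrt n := Real.nat_sqrt_le_real_sqrt
    have h3 : (q : ℝ) ≤ 2 * (Nat.sqrt n + 1) := by exact_mod_cast hq2
    linarith
  have hq0 : (0 : ℝ) < q := by exact_mod_cast hqp.pos
  obtain ⟨I, ℓ, hℓ, hdeg, hline⟩ := exists_incidence hnq
  set P := ⌈(n : ℝ) ^ (1 - δ - ε)⌉₊ with hPdef
  set N := ⌈(n : ℝ) ^ (δ - 1 / 2)⌉₊ with hNdef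
  set M := ⌈(n : ℝ) ^ c⌉₊ with hMdef
  set u := ⌈(32 * (s : ℝ) ^ 2 + 4) * (n : ℝ) ^ δ⌉₊ with hudef
  set w := u / (2 * q) + 1 with hwdef
  have hP1 : (n : ℝ) ^ (1 - δ - ε) ≤ P := Nat.le_ceil _
  have hN1 : (n : ℝ) ^ (δ - 1 / 2) ≤ N := Nat.le_ceil _
  have hM1 : (n : ℝ) ^ c ≤ M := Nat.le_ceil _
  have hu1 : (32 * (s : ℝ) ^ 2 + 4) * (n : ℝ) ^ δ ≤ u := Nat.le_ceil _
  have hP2 : (P : ℝ) ≤ 2 * (n : ℝ) ^ (1 - δ - ε) := natCeil_rpow_le hx1 (by linarith)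
  have hN2 : (N : ℝ) ≤ 2 * (n : ℝ) ^ (δ - 1 / 2) := natCeil_rpow_le hx1 (by linarith)
  have hM2 : (M : ℝ) ≤ 2 * (n : ℝ) ^ c := natCeil_rpow_le hx1 hc.le
  have hN0 : (0 : ℝ) < N := (Real.rpow_pos_of_pos hx _).trans_le hN1
  have hM0 : (0 : ℝ) < M := (Real.rpow_pos_of_pos hx _).trans_le hM1
  have hP0 : (0 : ℝ) < P := (Real.rpow_pos_of_pos hx _).trans_le hP1
  have : NeZero N := ⟨by rintro h; simp [h] at hN0⟩
  have : NeZero M := ⟨by rintro h; simp [h] at hM0⟩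
  have : NeZero s := ⟨hs0.ne'⟩
  have hPtwo : 2 ≤ P := by
    have : (1 : ℝ) < P := (Real.one_lt_rpow (by linarith) (by linarith)).trans_le hP1
    exact_mod_cast this
  have hδ0 : 1 ≤ (n : ℝ) ^ δ := Real.one_le_rpow hx1 (by linarith)
  have hu2 : (u : ℝ) ≤ (32 * (s : ℝ) ^ 2 + 5) * (n : ℝ) ^ δ := by
    have := Nat.ceil_lt_add_one (show 0 ≤ (32 * (s : ℝ) ^ 2 + 4) * (n : ℝ) ^ δ by positivity)
    rw [← hudef] at this
    linarith
  have hhalf : (n : ℝ) ^ (1 / 2 : ℝ) ≤ (n : ℝ) ^ δ := Real.rpow_le_rpow_of_exponent_le hx1 hδ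
  have hqu : q ≤ u := by
    have h1 : (q : ℝ) ≤ u := by
      refine hq4.trans (le_trans ?_ hu1)
      gcongr
      nlinarith [sq_nonneg (s : ℝ)]
    exact_mod_cast h1
  have hw : 2 * q * w ≤ u + 2 * q := by
    have := Nat.div_mul_le_self u (2 * q)
    rw [hwdef]
    linarith
  have hw2 : (u : ℝ) ≤ 2 * q * w := by
    have h := Nat.lt_div_mul_add (a := u) (b := 2 * q) (by have := hqp.pos; omega)
    have h' : u ≤ 2 * q * w := by rw [hwdef]; linarith
    exact_mod_cast h'
  have hNs : (s : ℝ) * (1 - 1 / (N * s)) ^ w ≤ 1 / 2 := by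
    refine mul_pow_le_half (by exact_mod_cast hN0) hs0 ?_
    have h1 : (N : ℝ) * (2 * q) ≤ 16 * (n : ℝ) ^ δ := by
      calc (N : ℝ) * (2 * q) ≤ (2 * (n : ℝ) ^ (δ - 1 / 2)) * (2 * (4 * (n : ℝ) ^ (1 / 2 : ℝ))) := by
            gcongr
        _ = 16 * ((n : ℝ) ^ (δ - 1 / 2) * (n : ℝ) ^ (1 / 2 : ℝ)) := by ring
        _ = 16 * (n : ℝ) ^ δ := by rw [← Real.rpow_add hx, sub_add_cancel]
    have h2 : 2 * (s : ℝ) * (N * s) * (2 * q) ≤ w * (2 * q) := by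
      calc 2 * (s : ℝ) * (N * s) * (2 * q) = 2 * (s : ℝ) ^ 2 * (N * (2 * q)) := by ring
        _ ≤ 2 * (s : ℝ) ^ 2 * (16 * (n : ℝ) ^ δ) := by gcongr
        _ ≤ (32 * (s : ℝ) ^ 2 + 4) * (n : ℝ) ^ δ := by linarith
        _ ≤ u := hu1
        _ ≤ w * (2 * q) := by linarith
    exact le_of_mul_le_mul_right h2 (by positivity)
  set X : ℝ := (n : ℝ) ^ c with hXdef
  have hX : 0 < X := Real.rpow_pos_of_pos hx _
  have hXP : X ≤ P * N ^ 2 := by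
    calc X ≤ (n : ℝ) ^ (δ - ε) := Real.rpow_le_rpow_of_exponent_le hx1 hcδ
      _ = (n : ℝ) ^ (1 - δ - ε) * ((n : ℝ) ^ (δ - 1 / 2)) ^ 2 := by
        rw [← Real.rpow_mul_natCast hx.le, ← Real.rpow_add hx]
        congr 1
        push_cast
        ring
      _ ≤ _ := by gcongr
  have hMn : (M : ℝ) ≤ 2 * n := by
    refine hM2.trans ?_
    have := Real.rpow_le_rpow_of_exponent_le hx1 hc1
    rw [Real.rpow_one] at this
    linarith
  have h64 : (64 : ℝ) ≤ n := by
    exact_mod_cast le_trans (Nat.le_mul_of_pos_right 64 (by positivity)) hnA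
  have hA := joined_bound hx1 hMn hj (by exact_mod_cast hnA)
  have hB := joined_line_bound hx1 hMn hq0.le hq4 hN1 hk (by exact_mod_cast hnB)
  have hg : (n : ℝ) ≤ 8 * (((q ^ 2 + 7) / 8 : ℕ) : ℝ) := by
    have : n ≤ 8 * ((q ^ 2 + 7) / 8) := by omega
    exact_mod_cast this
  have hU := rainbow_bound h64 (by linarith) hMn (by exact_mod_cast (by omega : 1 ≤ P)) hP2 hg hu2
    (by linarith)
  obtain ⟨G, hG1, hG2, hG3⟩ := exists_graph_of_incidence (P := P) (N := N) (M := M) (s := s)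
    (q := q) (r := r) (j := j) (k := k) (u := u) (w := w) hℓ
    (by simp [ZMod.card, sq]) hdeg hline hPtwo (by simpa using hn2) hqp.pos hqu hw hNs hcard hX
    hXP hM1 (by simpa using hA) (by simpa using hB) (by simpa using hU)
  refine ⟨G, hG1, Nat.lt_ceil.1 hG2, ?_⟩
  rw [Fintype.card_fin] at hG3
  rw [Real.rpow_sub hx, div_le_iff₀ hX]
  calc (n : ℝ) ^ (2 : ℝ) = (n : ℝ) ^ 2 := by norm_cast
    _ ≤ 16 * M * G.edgeSet.ncard := hG3
    _ ≤ 16 * (2 * X) * G.edgeSet.ncard := by gcongr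
    _ = _ := by ring

/-- The common source of both parts of the theorem. The condition `1 - δ < r * c` says that the common
neighbourhood of `r` points in the sparse random graph has fewer than `n ^ δ` points, and
`c ≤ δ - ε` that pairs on common selected lines are no denser than the sparse random edges. -/
theorem eventually_exists_graph {δ ε c : ℝ} {r : ℕ} (hδ : 1 / 2 ≤ δ) (hε : 0 < ε)
    (hεδ : ε < 1 - δ) (hc : 0 < c) (hcδ : c ≤ δ - ε) (hrc : 1 - δ < r * c) :
    ∃ s₀ : ℕ, ∀ s : ℕ, s₀ ≤ s → ∀ᶠ n : ℕ in atTop, ∃ G : SimpleGraph (Fin n),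
      G.CliqueFree (s + r) ∧ (sIndepNum s G : ℝ) < (32 * (s : ℝ) ^ 2 + 4) * (n : ℝ) ^ δ ∧
      (n : ℝ) ^ (2 - c) ≤ 32 * G.edgeSet.ncard := by
  obtain ⟨j, hj⟩ := exists_nat_ge (4 / c + 1)
  obtain ⟨k, hk⟩ := exists_nat_ge ((r + 3) / (c * r - (1 - δ)))
  have hγ : 0 < c * r - (1 - δ) := by linarith
  rw [div_le_iff₀ hγ] at hk
  have hj' : 2 * (j : ℝ) + 2 ≤ c * (j * j) := by
    have h0 : 0 < 4 / c := by positivity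
    have h1 : 4 ≤ j * c := (div_le_iff₀ hc).1 (by linarith)
    nlinarith
  refine ⟨2 * j + (2 * j) ^ 2 * (k + r ^ 2) + 1, fun s hs => ?_⟩
  have hlog : ∀ᶠ n : ℕ in atTop,
      (32 * (s : ℝ) ^ 2 + 7) * Real.log n ≤ (n : ℝ) ^ ε / 32 := by
    have h := ((isLittleO_log_rpow_atTop hε).comp_tendsto tendsto_natCast_atTop_atTop).def
      (show 0 < 1 / (32 * (32 * (s : ℝ) ^ 2 + 7)) by positivity)
    filter_upwards [h, eventually_ge_atTop 1] with n hn hn1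
    have hx1 : (1 : ℝ) ≤ n := by exact_mod_cast hn1
    simp only [Function.comp, Real.norm_eq_abs, abs_of_nonneg (Real.log_nonneg hx1),
      abs_of_nonneg (Real.rpow_nonneg (zero_le_one.trans hx1) ε)] at hn
    rw [div_mul_eq_mul_div, one_mul, le_div_iff₀ (by positivity)] at hn
    linarith
  filter_upwards [hlog, eventually_ge_atTop 2, eventually_ge_atTop (64 * 2 ^ (j * j)),
    eventually_ge_atTop (1024 * 4 ^ k * 2 ^ (r * k))] with n h1 h2 h3 h4
  exact exists_graph_of_large hδ hε hεδ hc hcδ (by omega) hj' hk (by omega) h2 h3 h4 h1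

end Parameters

/-! ### Ramsey–Turán numbers -/

section RamseyTuran

theorem ncard_edgeSet_le_ramseyTuran {W : Type*} {H : SimpleGraph W} {s n : ℕ} {f : ℝ}
    {G : SimpleGraph (Fin n)} (hH : H.Free G) (hf : (sIndepNum s G : ℝ) < f) :
    G.edgeSet.ncard ≤ ramseyTuran s n H f := by
  refine le_csSup ⟨Nat.card (Sym2 (Fin n)), ?_⟩ ⟨G, hH, hf, rfl⟩
  rintro m ⟨G', -, -, rfl⟩
  exact Set.ncard_le_card _

theorem isBigO_ramseyTuran {δ ε c e : ℝ} {r : ℕ} (hδ : 1 / 2 ≤ δ) (hε : 0 < ε)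
    (hεδ : ε < 1 - δ) (hc : 0 < c) (hcδ : c ≤ δ - ε) (hrc : 1 - δ < r * c) (he : e ≤ 2 - c)
    {f : ℕ → ℕ → ℝ}
    (hf : ∀ s : ℕ, ∀ᶠ n : ℕ in atTop, (32 * (s : ℝ) ^ 2 + 4) * (n : ℝ) ^ δ ≤ f s n) :
    ∃ s₀ : ℕ, ∀ s : ℕ, s₀ ≤ s → (fun n : ℕ => (n : ℝ) ^ e) =O[atTop]
      (fun n : ℕ => (ramseyTuran s n (SimpleGraph.completeGraph (Fin (s + r))) (f s n) : ℝ)) := by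
  obtain ⟨s₀, h⟩ := eventually_exists_graph hδ hε hεδ hc hcδ hrc
  refine ⟨s₀, fun s hs => IsBigO.of_bound 32 ?_⟩
  filter_upwards [h s hs, hf s, eventually_ge_atTop 1] with n ⟨G, hG1, hG2, hG3⟩ hn hn1
  have hx1 : (1 : ℝ) ≤ n := by exact_mod_cast hn1
  have hfree : (SimpleGraph.completeGraph (Fin (s + r))).Free G := by
    have := SimpleGraph.cliqueFree_iff_top_free (G := G) (β := Fin (s + r))
    rw [Fintype.card_fin] at this
    exact this.1 hG1
  have hle : (G.edgeSet.ncard : ℝ) ≤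
      ramseyTuran s n (SimpleGraph.completeGraph (Fin (s + r))) (f s n) := by
    exact_mod_cast ncard_edgeSet_le_ramseyTuran hfree (hG2.trans_le hn)
  rw [Real.norm_of_nonneg (by positivity), Real.norm_of_nonneg (by positivity)]
  linarith [Real.rpow_le_rpow_of_exponent_le hx1 he]

end RamseyTuran

theorem theorem3p3 :
    (∀ (r : ℕ) (ε δ : ℝ), 1 ≤ r → 0 < ε → 1 / 2 < δ → δ ≤ 1 / 2 + 1 / (2 * (2 * (r : ℝ) + 1)) →
      ∃ s₀ : ℕ, ∀ s : ℕ, s₀ ≤ s →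
        (fun n : ℕ => (n : ℝ) ^ (2 - (1 - δ) / (r : ℝ) - ε)) =O[atTop]
          (fun n : ℕ => (ramseyTuran s n (SimpleGraph.completeGraph (Fin (s + r))) ((n : ℝ) ^ δ) : ℝ))) ∧
    (∃ C : ℕ → ℝ, (∀ s : ℕ, 0 < C s) ∧
      ∀ (r : ℕ) (ε : ℝ), 2 ≤ r → 0 < ε →
        ∃ s₀ : ℕ, ∀ s : ℕ, s₀ ≤ s →
          (fun n : ℕ => (n : ℝ) ^ (2 - 1 / (2 * (r : ℝ)) - ε)) =O[atTop]
            (fun n : ℕ =>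
              (ramseyTuran s n (SimpleGraph.completeGraph (Fin (s + r))) (C s * Real.sqrt (n : ℝ)) : ℝ))) := by
  constructor
  · intro r ε δ hr hε hδ hδr
    have hr1 : (1 : ℝ) ≤ r := by exact_mod_cast hr
    have hδ1 : δ ≤ 2 / 3 := by
      have : 1 / (2 * (2 * (r : ℝ) + 1)) ≤ 1 / 6 := by
        apply one_div_le_one_div_of_le <;> linarith
      linarith
    -- Lowering the exponent `δ` by `η` absorbs the constant in front of `n ^ δ`.
    set η := min ((δ - 1 / 2) / 2) (ε / 4) with hη
    have hη0 : 0 < η := lt_min (by linarith) (by linarith)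
    have hη1 : η ≤ (δ - 1 / 2) / 2 := min_le_left _ _
    have hη2 : η ≤ ε / 4 := min_le_right _ _
    have hdiv : (1 - (δ - η)) / (r : ℝ) ≤ 1 - (δ - η) := div_le_self (by linarith) hr1
    have hdiv' : (1 - (δ - η)) / (r : ℝ) ≤ (1 - δ) / r + η := by
      rw [show 1 - (δ - η) = (1 - δ) + η by ring, add_div]
      linarith [div_le_self hη0.le hr1]
    have hdiv0 : 0 < (1 - (δ - η)) / (r : ℝ) := div_pos (by linarith) (by linarith)
    refine isBigO_ramseyTuran (δ := δ - η) (ε := η / 2) (c := (1 - (δ - η)) / r + η / 2)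
      (f := fun _ n => (n : ℝ) ^ δ) (by linarith) (by linarith) (by linarith) (by linarith)
      (by linarith) ?_ (by linarith) fun s => ?_
    · rw [mul_add, mul_div_cancel₀ _ (by linarith)]
      nlinarith
    · have h : Tendsto (fun n : ℕ => (n : ℝ) ^ η) atTop atTop :=
        (tendsto_rpow_atTop hη0).comp tendsto_natCast_atTop_atTop
      filter_upwards [h.eventually_ge_atTop (32 * (s : ℝ) ^ 2 + 4), eventually_ge_atTop 1]
        with n hn hn1
      have hx : (0 : ℝ) < n := by exact_mod_cast hn1
      calc (32 * (s : ℝ) ^ 2 + 4) * (n : ℝ) ^ (δ - η) ≤ (n : ℝ) ^ η * (n : ℝ) ^ (δ - η) := by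
            gcongr
        _ = (n : ℝ) ^ δ := by rw [← Real.rpow_add hx]; congr 1; ring
  · refine ⟨fun s : ℕ => 32 * (s : ℝ) ^ 2 + 4, fun s => by positivity, fun r ε hr hε => ?_⟩
    have hr2 : (2 : ℝ) ≤ r := by exact_mod_cast hr
    have hdiv : 1 / (2 * (r : ℝ)) ≤ 1 / 4 := by
      apply one_div_le_one_div_of_le <;> linarith
    have hdiv0 : 0 < 1 / (2 * (r : ℝ)) := by positivity
    have h1 : min ε (1 / 8) ≤ ε := min_le_left _ _
    have h2 : min ε (1 / 8) ≤ 1 / 8 := min_le_right _ _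
    have h0 : 0 < min ε (1 / 8) := lt_min hε (by norm_num)
    refine isBigO_ramseyTuran (δ := 1 / 2) (ε := 1 / 8) (c := 1 / (2 * r) + min ε (1 / 8))
      (f := fun (s n : ℕ) => (32 * (s : ℝ) ^ 2 + 4) * Real.sqrt n) le_rfl (by norm_num) (by norm_num)
      (by linarith) (by linarith) ?_ (by linarith) fun s => ?_
    · have : (r : ℝ) * (1 / (2 * r)) = 1 / 2 := by field_simp
      rw [mul_add, this]
      nlinarith
    · filter_upwards with n
      rw [Real.sqrt_eq_rpow]
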